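/- **Setting.** Let $x_L<x_R$, $c>0$, $N\ge 1$, $h=(x_R-x_L)/N$, $x_j=x_L+jh$, $\rho_j=x_j+h/2$, $I_j=[x_j,x_{j+1}]$, $I_{j+1/2}=[\rho_j,\rho_{j+1}]$, with periodic boundary conditions (indices modulo $N$). For $q_u\ge1$, $q_v\ge0$ let $U_h$ (resp. $V_h$) be the functions which are polynomials of degree $\le q_u$ on each $I_j$ (resp. of degree $\le q_v$ on each $I_{j+1/2}$). The staggered energy-based discontinuous Galerkin method with central fluxes for $u_t=v$, $v_t=c^2u_{xx}$ is the semi-discrete system $\frac{d}{dt}W=\mathcal L W$ for $W=(u,v)\in U_h\times V_h$, where $\mathcal L(u,v)=(r,s)\in U_h\times V_h$ is the unique pair such that for all $j$ and all polynomials $\phi,\psi$ of degree at most $q_u$, $q_v$ respectively $$\int_{I_j}c^2\phi_x r_x\,dx+\int_{I_j}c^2\phi_{xx}v\,dx=c^2\phi_x v\big|_{x_{j+1}}-c^2\phi_x v\big|_{x_j},$$ $$\int_{I_{j+1/2}}\psi s\,dx+\int_{I_{j+1/2}}c^2\psi_x u_x\,dx=c^2\psi u_x\big|_{\rho_{j+1}}-c^2\psi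 u_x\big|_{\rho_j},\qquad \int_{I_j}(r-v)\,dx=0,$$ derivatives of $u$ being taken element by element. Put $\|(u,v)\|_E=(\|cu_x\|_{L^2}^2+\|v\|_{L^2}^2)^{1/2}$, and let $\bar u$ be the piecewise constant function of the averages of $u$ over the $I_j$. A leap-frog scheme with coefficients $a_1,\dots,a_m\in\mathbb R$ for $w''=Bw$ is $$w^{n+1}-2w^n+w^{n-1}=\sum_{i=1}^m a_i(\Delta t^2B)^iw^n .$$ It has order (at least) $p$ if, for every bounded linear operator $B$ on a real normed space, every solution of $w''=Bw$ and every $t$, one has $w(t+\Delta t)-2w(t)+w(t-\Delta t)-\sum_i a_i(\Delta t^2B)^iw(t)=O(\Delta t^{p+2})$ as $\Delta t\to0$. The fully discrete method is this scheme with $B=\mathcal L^2$; a step has $2m$ stages (applications of $\mathcal L$). **Theorem.** There are constants $C_1,C_2>0$ and, for every integer $q_T\ge1$, a leap-frog scheme (independent of $q_u,q_v$ and of the mesh) of order $q_T$ with at most $C_2q_T$ stages and a constant $K=K(q_T)$ such that the following holds for all $q_u\ge1$, $q_v\ge0$ with $\max(q_u,q_v)\le q_T$, all $x_L<x_R$,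 $N\ge1$, $c>0$, and all $\Delta t>0$ satisfying the CFL condition $c\,\Delta t\le C_1h$. The fully discrete method is stable, i.e. each of its solutions $W^n=(u^n,v^n)$ satisfies, for all $n\ge0$ and with $t_n=n\Delta t$, $D^n=(W^{n+1}-W^n)/\Delta t$: 1. if $W^1=W^0+\Delta t\,\mathcal LZ$ for some $Z\in U_h\times V_h$ (starting values belonging to the first order system), then $\|W^n\|_E\le K(\|W^0\|_E+\|Z\|_E)$ and $\|\bar u^n\|_{L^2}\le\|\bar u^0\|_{L^2}+Kt_n(\|W^0\|_E+\|Z\|_E)$; 2. for arbitrary $W^0,W^1$: $\|W^n\|_E\le K(\|W^0\|_E+t_n\|D^0\|_E)$; 3. for arbitrary $W^0,W^1$: $\|D^n\|_E+\|\mathcal LW^n\|_E\le K(\|D^0\|_E+\|\mathcal LW^0\|_E)$. In particular $C_1$ and $C_2$ do not depend on $q_u$, $q_v$, $q_T$, $c$, $h$ or the domain. -/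

import Mathlib

open Polynomial
open scoped Topology

noncomputable section

namespace StaggeredDG

/-! ### Broken polynomial spaces on the two staggered periodic grids

The period `[x_L, x_R]` is cut into `N` elements of length `h`.  The primal elements are
`I_j = [x_j, x_{j+1}]`, the dual ones are `I_{j+1/2} = [ρ_j, ρ_{j+1}]` with `ρ_j = x_j + h/2`;
indices are taken modulo `N` (periodic boundary conditions).  A polynomial on an element is written
in the local coordinate `s ∈ [0, h]`, the distance from the left end of the element.  Hence
`v` on `I_j` is `v_{j-1}(s + h/2)` on the left half and `v_j(s - h/2)` on the right half, and
`u` on `I_{j+1/2}` is `u_j(s + h/2)` on the left half and `u_{j+1}(s - h/2)` on the right half. -/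

/-- Piecewise polynomials of degree at most `q` on a periodic grid of `N` elements. -/
abbrev BrokenSpace (N q : ℕ) : Type := ZMod N → degreeLT ℝ (q + 1)

/-- The unknowns `(u, v)`: displacement on the primal grid, velocity on the dual grid. -/
abbrev State (N qu qv : ℕ) : Type := BrokenSpace N qu × BrokenSpace N qv

variable {N qu qv : ℕ}

/-- The polynomial representing `u` on `I_j`. -/
def upoly (W : State N qu qv) (j : ZMod N) : ℝ[X] := (W.1 j : ℝ[X])

/-- The polynomial representing `u_x` on `I_j`. -/
def wpoly (W : State N qu qv) (j : ZMod N) : ℝ[X] := derivative (upoly W j)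

/-- The polynomial representing `v` on `I_{j+1/2}`. -/
def vpoly (W : State N qu qv) (j : ZMod N) : ℝ[X] := (W.2 j : ℝ[X])

/-- The numerical flux `v^* = v - β c² (u_x^- - u_x^+)` at `x_j`, the centre of `I_{j-1/2}`. -/
def vStar (c β h : ℝ) (W : State N qu qv) (j : ZMod N) : ℝ :=
  (vpoly W (j - 1)).eval (h / 2)
    - β * c ^ 2 * ((wpoly W (j - 1)).eval h - (wpoly W j).eval 0)

/-- The numerical flux `u_x^* = u_x - (τ / c²) (v^- - v^+)` at `ρ_j`, the centre of `I_j`. -/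
def wStar (c τ h : ℝ) (W : State N qu qv) (j : ZMod N) : ℝ :=
  (wpoly W j).eval (h / 2)
    - τ / c ^ 2 * ((vpoly W (j - 1)).eval h - (vpoly W j).eval 0)

/-- `R = (∂u/∂t, ∂v/∂t)` is the time derivative which the staggered energy-based discontinuous
Galerkin scheme assigns to `W = (u, v)`: the three variational equations hold on every element, for
all polynomial test functions. -/
structure IsTimeDerivative (c β τ h : ℝ) (W R : State N qu qv) : Prop where
  eq_u : ∀ (j : ZMod N) (φ : ℝ[X]), φ ∈ degreeLT ℝ (qu + 1) →
    (∫ s in (0 : ℝ)..h, c ^ 2 * (derivative φ).eval s * (wpoly R j).eval s)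
      + ((∫ s in (0 : ℝ)..(h / 2),
            c ^ 2 * (derivative (derivative φ)).eval s * (vpoly W (j - 1)).eval (s + h / 2))
        + ∫ s in (h / 2)..h,
            c ^ 2 * (derivative (derivative φ)).eval s * (vpoly W j).eval (s - h / 2))
      = c ^ 2 * (derivative φ).eval h * vStar c β h W (j + 1)
        - c ^ 2 * (derivative φ).eval 0 * vStar c β h W j
  eq_v : ∀ (j : ZMod N) (ψ : ℝ[X]), ψ ∈ degreeLT ℝ (qv + 1) →
    (∫ s in (0 : ℝ)..h, ψ.eval s * (vpoly R j).eval s)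
      + ((∫ s in (0 : ℝ)..(h / 2),
            c ^ 2 * (derivative ψ).eval s * (wpoly W j).eval (s + h / 2))
        + ∫ s in (h / 2)..h,
            c ^ 2 * (derivative ψ).eval s * (wpoly W (j + 1)).eval (s - h / 2))
      = c ^ 2 * ψ.eval h * wStar c τ h W (j + 1)
        - c ^ 2 * ψ.eval 0 * wStar c τ h W j
  eq_mean : ∀ j : ZMod N,
    (∫ s in (0 : ℝ)..h, (upoly R j).eval s)
      = (∫ s in (0 : ℝ)..(h / 2), (vpoly W (j - 1)).eval (s + h / 2))
        + ∫ s in (h / 2)..h, (vpoly W j).eval (s - h / 2)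

/-! ### The scheme determines the time derivative -/

theorem eq_zero_of_integral_sq {h : ℝ} (hh : 0 < h) (p : ℝ[X])
    (hp : (∫ s in (0 : ℝ)..h, p.eval s * p.eval s) = 0) : p = 0 := by
  have hz : ∀ x ∈ Set.Icc (0 : ℝ) h, p.eval x = 0 := by
    by_contra hcon
    push Not at hcon
    obtain ⟨x, hx, hne⟩ := hcon
    have := intervalIntegral.integral_pos (f := fun s => p.eval s * p.eval s) hh
      (by fun_prop) (fun y _ => mul_self_nonneg _) ⟨x, hx, mul_self_pos.mpr hne⟩
    exact absurd hp this.ne'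
  refine Polynomial.eq_zero_of_infinite_isRoot p ((Set.Icc_infinite hh).mono ?_)
  intro x hx
  exact hz x hx

/-- Integration against a fixed continuous function, as a linear functional of the polynomial. -/
def intFun (a b : ℝ) (g : ℝ → ℝ) (hg : Continuous g) : ℝ[X] →ₗ[ℝ] ℝ where
  toFun p := ∫ s in a..b, p.eval s * g s
  map_add' p q := by
    simp only [eval_add, add_mul]
    exact intervalIntegral.integral_add
      (Continuous.intervalIntegrable (by fun_prop) _ _)
      (Continuous.intervalIntegrable (by fun_prop) _ _)
  map_smul' r p := by
    simp only [eval_smul, smul_eq_mul, mul_assoc, RingHom.id_apply]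
    exact intervalIntegral.integral_const_mul _ _

instance (n : ℕ) : FiniteDimensional ℝ (degreeLT ℝ n) :=
  Module.Finite.equiv (degreeLTEquiv ℝ n).symm

/-- A positive definite symmetric form on a finite-dimensional space represents all functionals. -/
theorem exists_rep {V : Type} [AddCommGroup V] [Module ℝ V] [FiniteDimensional ℝ V]
    (g : V →ₗ[ℝ] V →ₗ[ℝ] ℝ) (hg : ∀ r, g r r = 0 → r = 0) (F : V →ₗ[ℝ] ℝ) :
    ∃ r, ∀ φ, g r φ = F φ := by
  have hinj : Function.Injective (g : V →ₗ[ℝ] Module.Dual ℝ V) := by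
    refine (injective_iff_map_eq_zero _).mpr fun r hr => hg r ?_
    rw [hr]; rfl
  have hsurj := (LinearMap.injective_iff_surjective_of_finrank_eq_finrank
    (Subspace.dual_finrank_eq (K := ℝ) (V := V)).symm).mp hinj
  obtain ⟨r, hr⟩ := hsurj F
  exact ⟨r, fun φ => by rw [hr]⟩

/-- The mass form `∫ p q`. -/
def massForm (h : ℝ) : ℝ[X] →ₗ[ℝ] ℝ[X] →ₗ[ℝ] ℝ :=
  LinearMap.mk₂ ℝ (fun p q => ∫ s in (0 : ℝ)..h, p.eval s * q.eval s)
    (fun p p' q => (intFun 0 h (fun s => q.eval s) (by fun_prop)).map_add p p')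
    (fun r p q => (intFun 0 h (fun s => q.eval s) (by fun_prop)).map_smul r p)
    (fun p q q' => by
      simp only [mul_comm (eval _ p)]
      exact (intFun 0 h (fun s => p.eval s) (by fun_prop)).map_add q q')
    (fun r p q => by
      simp only [mul_comm (eval _ p)]
      exact (intFun 0 h (fun s => p.eval s) (by fun_prop)).map_smul r q)

theorem massForm_apply (h : ℝ) (p q : ℝ[X]) :
    massForm h p q = ∫ s in (0 : ℝ)..h, p.eval s * q.eval s := rfl

/-- Representation in `Q^q`: the mass matrix is invertible. -/
theorem exists_mass {h : ℝ} (hh : 0 < h) (n : ℕ) (F : ℝ[X] →ₗ[ℝ] ℝ) :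
    ∃ r ∈ degreeLT ℝ n, ∀ φ ∈ degreeLT ℝ n, (∫ s in (0 : ℝ)..h, φ.eval s * r.eval s) = F φ := by
  let ι := (degreeLT ℝ n).subtype
  obtain ⟨r, hr⟩ := exists_rep ((massForm h).compl₁₂ ι ι) (fun r hr => by
    apply Subtype.ext
    exact eq_zero_of_integral_sq hh _ hr) (F ∘ₗ ι)
  refine ⟨r, r.2, fun φ hφ => ?_⟩
  have := hr ⟨φ, hφ⟩
  simp only [LinearMap.compl₁₂_apply, massForm_apply, LinearMap.comp_apply, ι,
    Submodule.subtype_apply] at this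
  rw [← this]
  simp only [mul_comm]

/-- Representation for the form `∫ c² p_x q_x`, with a prescribed integral: the mass matrix of the
displacement equation together with the equation for the cell average is invertible. -/
theorem exists_stiff {c h : ℝ} (hc : 0 < c) (hh : 0 < h) (n : ℕ) (hn : 0 < n)
    (F : ℝ[X] →ₗ[ℝ] ℝ) (m : ℝ) :
    ∃ r ∈ degreeLT ℝ n,
      (∀ φ ∈ degreeLT ℝ n,
        (∫ s in (0 : ℝ)..h, c ^ 2 * (derivative φ).eval s * (derivative r).eval s)
          = F (derivative φ)) ∧
      (∫ s in (0 : ℝ)..h, r.eval s) = m := by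
  let ι := (degreeLT ℝ n).subtype
  let D : ℝ[X] →ₗ[ℝ] ℝ[X] := derivative
  let mean : ℝ[X] →ₗ[ℝ] ℝ := intFun 0 h (fun _ => 1) continuous_const
  have hmean : ∀ p, mean p = ∫ s in (0 : ℝ)..h, p.eval s := fun p => by
    simp [mean, intFun]
  let g : ℝ[X] →ₗ[ℝ] ℝ[X] →ₗ[ℝ] ℝ :=
    c ^ 2 • (massForm h).compl₁₂ D D + (LinearMap.mul ℝ ℝ).compl₁₂ mean mean
  have hgapp : ∀ p q, g p q = c ^ 2 * (∫ s in (0 : ℝ)..h, (derivative p).eval s *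
      (derivative q).eval s) + mean p * mean q := fun p q => rfl
  have hdef : ∀ r : degreeLT ℝ n, (g.compl₁₂ ι ι) r r = 0 → r = 0 := by
    intro r hr
    have hr' : g (r : ℝ[X]) r = 0 := hr
    rw [hgapp] at hr'
    have h1 : 0 ≤ ∫ s in (0 : ℝ)..h, (derivative (r : ℝ[X])).eval s *
        (derivative (r : ℝ[X])).eval s :=
      intervalIntegral.integral_nonneg hh.le (fun _ _ => mul_self_nonneg _)
    have h2 := mul_self_nonneg (mean (r : ℝ[X]))
    have hc2 : 0 < c ^ 2 := by positivity
    have h3 : (∫ s in (0 : ℝ)..h, (derivative (r : ℝ[X])).eval s *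
        (derivative (r : ℝ[X])).eval s) = 0 := by
      have := mul_nonneg hc2.le h1
      have h0 : c ^ 2 * (∫ s in (0 : ℝ)..h, (derivative (r : ℝ[X])).eval s *
        (derivative (r : ℝ[X])).eval s) = 0 := by linarith
      exact (mul_eq_zero.mp h0).resolve_left hc2.ne'
    have h4 : mean (r : ℝ[X]) = 0 := by
      rw [h3] at hr'
      simpa using hr'
    have h5 := eq_zero_of_integral_sq hh _ h3
    have h6 := Polynomial.eq_C_of_derivative_eq_zero h5
    apply Subtype.ext
    rw [hmean, h6] at h4
    simp only [eval_C, intervalIntegral.integral_const, smul_eq_mul, sub_zero] at h4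
    rw [h6, (mul_eq_zero.mp h4).resolve_left hh.ne']
    simp
  obtain ⟨r, hr⟩ := exists_rep (g.compl₁₂ ι ι) hdef ((F ∘ₗ D + m • mean) ∘ₗ ι)
  have hr' : ∀ φ ∈ degreeLT ℝ n, c ^ 2 * (∫ s in (0 : ℝ)..h, (derivative (r : ℝ[X])).eval s *
      (derivative φ).eval s) + mean r * mean φ = F (derivative φ) + m * mean φ := by
    intro φ hφ
    exact hr ⟨φ, hφ⟩
  have hone : mean (r : ℝ[X]) = m := by
    have h1 := hr' 1 (by
      rw [mem_degreeLT, degree_one]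
      exact_mod_cast hn)
    have h2 : mean (1 : ℝ[X]) = h := by rw [hmean]; simp
    rw [h2] at h1
    simp only [derivative_one, eval_zero, mul_zero, intervalIntegral.integral_zero, zero_add,
      map_zero] at h1
    exact mul_right_cancel₀ hh.ne' h1
  refine ⟨r, r.2, fun φ hφ => ?_, by rw [← hmean, hone]⟩
  have h1 := hr' φ hφ
  rw [hone] at h1
  rw [← add_right_cancel h1, ← intervalIntegral.integral_const_mul]
  congr 1
  ext s
  ring

/-- The variational equations have a solution. -/
theorem exists_isTimeDerivative {c h : ℝ} (β τ : ℝ) (hc : 0 < c) (hh : 0 < h)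
    (W : State N qu qv) : ∃ R : State N qu qv, IsTimeDerivative c β τ h W R := by
  have cont : ∀ (p : ℝ[X]) (a : ℝ), Continuous fun s => c ^ 2 * p.eval (s + a) := by
    intro p a; fun_prop
  let ev : ℝ → ℝ[X] →ₗ[ℝ] ℝ := fun a => Polynomial.leval a
  let D : ℝ[X] →ₗ[ℝ] ℝ[X] := derivative
  let F1 : ZMod N → ℝ[X] →ₗ[ℝ] ℝ := fun j =>
    (c ^ 2 * vStar c β h W (j + 1)) • ev h - (c ^ 2 * vStar c β h W j) • ev 0
      - (intFun 0 (h / 2) _ (cont (vpoly W (j - 1)) (h / 2))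
        + intFun (h / 2) h _ (cont (vpoly W j) (-(h / 2)))) ∘ₗ D
  let F2 : ZMod N → ℝ[X] →ₗ[ℝ] ℝ := fun j =>
    (c ^ 2 * wStar c τ h W (j + 1)) • ev h - (c ^ 2 * wStar c τ h W j) • ev 0
      - (intFun 0 (h / 2) _ (cont (wpoly W j) (h / 2))
        + intFun (h / 2) h _ (cont (wpoly W (j + 1)) (-(h / 2)))) ∘ₗ D
  choose r hr hr1 hr3 using fun j : ZMod N => exists_stiff hc hh (qu + 1) (Nat.succ_pos _) (F1 j)
    ((∫ s in (0 : ℝ)..(h / 2), (vpoly W (j - 1)).eval (s + h / 2))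
        + ∫ s in (h / 2)..h, (vpoly W j).eval (s - h / 2))
  choose q hq hq1 using fun j : ZMod N => exists_mass hh (qv + 1) (F2 j)
  refine ⟨(fun j => ⟨r j, hr j⟩, fun j => ⟨q j, hq j⟩), ⟨?_, ?_, ?_⟩⟩
  · intro j φ hφ
    have h1 := hr1 j φ hφ
    simp only [F1, ev, D, intFun, LinearMap.sub_apply, LinearMap.smul_apply, leval_apply,
      LinearMap.comp_apply, LinearMap.add_apply, LinearMap.coe_mk, AddHom.coe_mk,
      smul_eq_mul] at h1
    simp only [wpoly, upoly]
    rw [h1]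
    simp only [← sub_eq_add_neg, mul_left_comm _ (c ^ 2), mul_assoc]
    ring
  · intro j ψ hψ
    have h1 := hq1 j ψ hψ
    simp only [F2, ev, D, intFun, LinearMap.sub_apply, LinearMap.smul_apply, leval_apply,
      LinearMap.comp_apply, LinearMap.add_apply, LinearMap.coe_mk, AddHom.coe_mk,
      smul_eq_mul] at h1
    simp only [vpoly] at h1 ⊢
    rw [h1]
    simp only [← sub_eq_add_neg, mul_left_comm _ (c ^ 2), mul_assoc]
    ring
  · intro j
    exact hr3 j

/-- The variational equations have at most one solution. -/
theorem isTimeDerivative_unique {c β τ h : ℝ} (hc : 0 < c) (hh : 0 < h)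
    {W R R' : State N qu qv} (hR : IsTimeDerivative c β τ h W R)
    (hR' : IsTimeDerivative c β τ h W R') : R = R' := by
  have hc2 : c ^ 2 ≠ 0 := by positivity
  apply Prod.ext
  · funext j
    apply Subtype.ext
    have hmem : (R.1 j : ℝ[X]) - (R'.1 j : ℝ[X]) ∈ degreeLT ℝ (qu + 1) :=
      Submodule.sub_mem _ (R.1 j).2 (R'.1 j).2
    have h1 := add_right_cancel ((hR.eq_u j _ hmem).trans (hR'.eq_u j _ hmem).symm)
    have h2 : (derivative ((R.1 j : ℝ[X]) - (R'.1 j : ℝ[X]))) = 0 := by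
      apply eq_zero_of_integral_sq hh
      rw [← sub_eq_zero, ← intervalIntegral.integral_sub
        (Continuous.intervalIntegrable (by fun_prop) _ _)
        (Continuous.intervalIntegrable (by fun_prop) _ _)] at h1
      have : (fun s => c ^ 2 * (derivative ((R.1 j : ℝ[X]) - (R'.1 j : ℝ[X]))).eval s * (wpoly R j).eval s
          - c ^ 2 * (derivative ((R.1 j : ℝ[X]) - (R'.1 j : ℝ[X]))).eval s * (wpoly R' j).eval s)
          = fun s => c ^ 2 * ((derivative ((R.1 j : ℝ[X]) - (R'.1 j : ℝ[X]))).eval s *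
            (derivative ((R.1 j : ℝ[X]) - (R'.1 j : ℝ[X]))).eval s) := by
        funext s
        simp only [wpoly, upoly, derivative_sub, eval_sub]
        ring
      rw [this, intervalIntegral.integral_const_mul] at h1
      exact (mul_eq_zero.mp h1).resolve_left hc2
    have h3 := Polynomial.eq_C_of_derivative_eq_zero h2
    have h4 : (∫ s in (0 : ℝ)..h, ((R.1 j : ℝ[X]) - (R'.1 j : ℝ[X])).eval s) = 0 := by
      simp only [eval_sub]
      rw [intervalIntegral.integral_sub (Continuous.intervalIntegrable (by fun_prop) _ _)
        (Continuous.intervalIntegrable (by fun_prop) _ _)]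
      exact sub_eq_zero.mpr ((hR.eq_mean j).trans (hR'.eq_mean j).symm)
    rw [h3] at h4
    simp only [eval_C, intervalIntegral.integral_const, smul_eq_mul, sub_zero] at h4
    rw [(mul_eq_zero.mp h4).resolve_left hh.ne', C_0] at h3
    exact sub_eq_zero.mp h3
  · funext j
    apply Subtype.ext
    have hmem : (R.2 j : ℝ[X]) - (R'.2 j : ℝ[X]) ∈ degreeLT ℝ (qv + 1) :=
      Submodule.sub_mem _ (R.2 j).2 (R'.2 j).2
    have h1 := add_right_cancel ((hR.eq_v j _ hmem).trans (hR'.eq_v j _ hmem).symm)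
    refine sub_eq_zero.mp (eq_zero_of_integral_sq hh _ ?_)
    rw [← sub_eq_zero, ← intervalIntegral.integral_sub
      (Continuous.intervalIntegrable (by fun_prop) _ _)
      (Continuous.intervalIntegrable (by fun_prop) _ _)] at h1
    rw [← h1]
    congr 1
    funext s
    simp only [vpoly, eval_sub]
    ring

open scoped Classical in
/-- The spatial operator `W ↦ ∂W/∂t` of the semi-discrete scheme (`M⁻¹ A` in matrix notation), that
is, the unique solution of the variational equations; `0` for meaningless parameters. -/
def spatialOp (c β τ h : ℝ) (W : State N qu qv) : State N qu qv :=
  if H : 0 < c ∧ 0 < h then (exists_isTimeDerivative β τ H.1 H.2 W).choose else 0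

/-- The spatial operator solves the variational equations. -/
theorem spatialOp_spec {c h : ℝ} (β τ : ℝ) (hc : 0 < c) (hh : 0 < h) (W : State N qu qv) :
    IsTimeDerivative c β τ h W (spatialOp c β τ h W) := by
  rw [spatialOp, dif_pos ⟨hc, hh⟩]
  exact (exists_isTimeDerivative β τ hc hh W).choose_spec

/-! ### Norms -/

/-- The energy (semi)norm `(‖c u_x‖² + ‖v‖²)^{1/2}`, with `L²` norms over one period.  It vanishes
exactly if `v = 0` and `u` is constant on every element. -/
def energyNorm [NeZero N] (c h : ℝ) (W : State N qu qv) : ℝ :=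
  √((∑ j : ZMod N, ∫ s in (0 : ℝ)..h, (c * (wpoly W j).eval s) ^ 2)
    + ∑ j : ZMod N, ∫ s in (0 : ℝ)..h, ((vpoly W j).eval s) ^ 2)

/-- The `L²` norm over one period of the piecewise constant function of the cell averages of `u`. -/
def averageNorm [NeZero N] (h : ℝ) (W : State N qu qv) : ℝ :=
  √(∑ j : ZMod N, h * (h⁻¹ * ∫ s in (0 : ℝ)..h, (upoly W j).eval s) ^ 2)

/-! ### Stability-enhanced leap-frog schemes -/

/-- A multistage leap-frog scheme for second order equations `w'' = B w`:
`w^{n+1} - 2 w^n + w^{n-1} = ∑_{i=1}^{m} a_i (Δt² B)^i w^n`, with `m = len`. -/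
structure LeapFrogScheme where
  /-- number `m` of applications of `B` in a step -/
  len : ℕ
  /-- the coefficients `a_1, …, a_m` -/
  coeff : Fin len → ℝ

namespace LeapFrogScheme

/-- The right-hand side `∑_{i=1}^{m} a_i (Δt² B)^i x`. -/
def increment (S : LeapFrogScheme) {E : Type} [AddCommGroup E] [Module ℝ E]
    (B : E → E) (dt : ℝ) (x : E) : E :=
  ∑ i : Fin S.len, (S.coeff i * dt ^ (2 * (i.val + 1))) • (B^[i.val + 1]) x

/-- The number of stages of one step for `w'' = L (L w)`, each stage being one application of the
first order operator `L`: two for each application of `B = L ∘ L`. -/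
def stages (S : LeapFrogScheme) : ℕ := 2 * S.len

/-- The scheme has order (at least) `p`: for every solution of a linear equation `w'' = B w` the
residual, divided by `Δt²`, is `O(Δt^p)`. -/
def HasOrder (S : LeapFrogScheme) (p : ℕ) : Prop :=
  ∀ (E : Type) [NormedAddCommGroup E] [NormedSpace ℝ E] (B : E →L[ℝ] E) (w w' : ℝ → E),
    (∀ t, HasDerivAt w (w' t) t) → (∀ t, HasDerivAt w' (B (w t)) t) →
    ∀ t : ℝ,
      (fun dt : ℝ => w (t + dt) - (2 : ℝ) • w t + w (t - dt) - S.increment B dt (w t))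
        =O[𝓝 0] fun dt : ℝ => dt ^ (p + 2)

/-- `W^0, W^1, W^2, …` is produced by the fully discrete method: the leap-frog scheme applied to the
semi-discrete equation `W'' = L (L W)`, where `L` is the spatial operator. -/
def IsDiscreteSolution (S : LeapFrogScheme) (c β τ h dt : ℝ) (W : ℕ → State N qu qv) : Prop :=
  ∀ n : ℕ, W (n + 2) = (2 : ℝ) • W (n + 1) - W n
    + S.increment (fun X => spatialOp c β τ h (spatialOp c β τ h X)) dt (W (n + 1))

/-- Stability of the fully discrete method, with constant `K`, for all solutions and all times.
* `first_order`: if the starting values belong to the first order system, `W^1 = W^0 + Δt L Z`, then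
  the energy norm of `W^n` is bounded uniformly in time, and the cell averages of `u`, which are
  integrals in time of `v`, grow at most linearly in time;
* `growth`: for arbitrary `W^0, W^1` the solution of the second order equation grows at most
  linearly in time (which is what solutions of `w'' = 0` do);
* `energy`: the discrete energy of the second order equation is bounded uniformly in time. -/
structure IsStable [NeZero N] (S : LeapFrogScheme) (qu qv : ℕ) (c β τ h dt K : ℝ) : Prop where
  first_order : ∀ W : ℕ → State N qu qv, S.IsDiscreteSolution c β τ h dt W →
    ∀ Z : State N qu qv, W 1 = W 0 + dt • spatialOp c β τ h Z →
    ∀ n : ℕ,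
      energyNorm c h (W n) ≤ K * (energyNorm c h (W 0) + energyNorm c h Z) ∧
      averageNorm h (W n) ≤ averageNorm h (W 0)
        + K * (n * dt) * (energyNorm c h (W 0) + energyNorm c h Z)
  growth : ∀ W : ℕ → State N qu qv, S.IsDiscreteSolution c β τ h dt W →
    ∀ n : ℕ, energyNorm c h (W n)
      ≤ K * (energyNorm c h (W 0) + n * dt * energyNorm c h (dt⁻¹ • (W 1 - W 0)))
  energy : ∀ W : ℕ → State N qu qv, S.IsDiscreteSolution c β τ h dt W →
    ∀ n : ℕ, energyNorm c h (dt⁻¹ • (W (n + 1) - W n)) + energyNorm c h (spatialOp c β τ h (W n))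
      ≤ K * (energyNorm c h (dt⁻¹ • (W 1 - W 0)) + energyNorm c h (spatialOp c β τ h (W 0)))

end LeapFrogScheme

end StaggeredDG

end

noncomputable section

namespace StaggeredDG

/-! With central fluxes, `L = spatialOp c 0 0 h` is skew for the energy semi-inner product. Put `l =
dt • L` and let `P(z) = ∑ a_i z^i`. The method is then the recursion `W^{n+2} = (2 + P(l²)) W^{n+1}
- W^n`, where `l²` is symmetric with spectrum in `[-‖l‖², 0]`. By functional calculus stability
becomes a scalar question: on `[-M², 0]` with `M ≥ ‖l‖`, the quotient `P(z)/z` must stay between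
positive constants and `4 + P` must stay above a positive constant. Both `‖L‖` and the admissible
`M` turn out to be linear in the degree, so the CFL constant does not depend on it.

The scheme. The exact solution satisfies `w(t+s) + w(t-s) = 2 cos(√(-s²B)) w(t)`. The degree `q`
Taylor polynomial of this cosine exceeds 1 at `z = -x²` by at most `u = x^{2q+2}/(2q+2)!` in
absolute value. Multiplying it by `1 - u` leaves the coefficients up to degree `q` unchanged and
gives the bound `1 - u² < 1` as long as `0 < u ≤ 1`, which holds for `0 < 3x ≤ 2q+2`
(`abs_eval_dampedCos_lt`, `exists_bounds_incrementPoly`).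

The operator. `‖L‖ ≤ 4c(q+1)/h` rather than `O(q²)`, because the grids are staggered: the end of an
element of one grid is the centre of an element of the other. In the coupling of the two grids a
linear cut-off shifts derivatives so that each falls on a polynomial with a weight vanishing at the
ends of its own element. There the Legendre-weighted inverse inequality loses only one power of `q`
(`integral_weight_deriv_sq_le`, `abs_couplingForm_le`, `energyNorm_spatialOp_le`).

The time estimates. The solution of the recursion is a combination of the Chebyshev-like polynomials
`recPoly P n` in `l²`. Their quadratic invariant bounds their differences, and also `√(-z) recPoly P
n`, uniformly in `n`; all three stability statements follow. The energy seminorm does not see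
piecewise constants, so the cell averages are followed separately through the increments. -/

variable {N qu qv : ℕ}

/-! ### Taylor expansion of `w(t + s) + w(t - s)` with sharp remainder. -/

/-- Remainder of the even part of the Taylor expansion of a solution of `w'' = B w`. -/
def evenRemainder {E : Type} [NormedAddCommGroup E] [NormedSpace ℝ E] (B : E →L[ℝ] E)
    (w : ℝ → E) (t : ℝ) (r : ℕ) (s : ℝ) : E :=
  w (t + s) + w (t - s)
    - ∑ k ∈ Finset.range r, (2 * s ^ (2 * k) / (2 * k).factorial) • (B^[k]) (w t)

section
variable {E : Type} [NormedAddCommGroup E] [NormedSpace ℝ E]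

theorem hasDerivAt_even_sum (B : E →L[ℝ] E) (x : E) (r : ℕ) (s : ℝ) :
    HasDerivAt (fun s : ℝ => ∑ k ∈ Finset.range (r + 1),
        (2 * s ^ (2 * k) / (2 * k).factorial) • (B^[k]) x)
      (∑ k ∈ Finset.range r, (2 * s ^ (2 * k + 1) / (2 * k + 1).factorial) • (B^[k + 1]) x) s := by
  simp only [Finset.sum_range_succ' _ r]
  rw [← add_zero (∑ k ∈ Finset.range r, _)]
  refine HasDerivAt.add (HasDerivAt.fun_sum fun k _ => ?_) ?_
  · refine HasDerivAt.smul_const ?_ _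
    have h := ((hasDerivAt_pow (2 * (k + 1)) s).const_mul 2).div_const
      ((2 * (k + 1)).factorial : ℝ)
    refine h.congr_deriv ?_
    have e : 2 * (k + 1) = (2 * k + 1) + 1 := by ring
    rw [e, Nat.factorial_succ (2 * k + 1), Nat.add_sub_cancel]
    have : ((2 * k + 1).factorial : ℝ) ≠ 0 := by positivity
    push_cast
    field_simp
  · simpa using hasDerivAt_const s ((2 : ℝ) • x)

theorem hasDerivAt_odd_sum (B : E →L[ℝ] E) (x : E) (r : ℕ) (s : ℝ) :
    HasDerivAt (fun s : ℝ => ∑ k ∈ Finset.range r,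
        (2 * s ^ (2 * k + 1) / (2 * k + 1).factorial) • (B^[k + 1]) x)
      (B (∑ k ∈ Finset.range r, (2 * s ^ (2 * k) / (2 * k).factorial) • (B^[k]) x)) s := by
  rw [map_sum]
  refine HasDerivAt.fun_sum fun k _ => ?_
  rw [map_smul, ← Function.iterate_succ_apply' B]
  refine HasDerivAt.smul_const ?_ _
  have h := ((hasDerivAt_pow (2 * k + 1) s).const_mul 2).div_const ((2 * k + 1).factorial : ℝ)
  refine h.congr_deriv ?_
  rw [Nat.factorial_succ (2 * k), Nat.add_sub_cancel]
  have : ((2 * k).factorial : ℝ) ≠ 0 := by positivity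
  push_cast
  field_simp

/-- The remainder of index `r + 1` vanishes at `0` together with its derivative `H`, and its second
derivative is `B` applied to the remainder of index `r`; so the bound is integrated twice at each
induction step. The explicit constant matters: for `w = cos` and `B = -1` it gives the sharp bound
behind the damping factor. -/
theorem norm_evenRemainder_le_of_nonneg (B : E →L[ℝ] E) {w w' : ℝ → E}
    (hw : ∀ t, HasDerivAt w (w' t) t) (hw' : ∀ t, HasDerivAt w' (B (w t)) t) (t : ℝ) {b M : ℝ}
    (hM : ∀ s ∈ Set.Icc (0 : ℝ) b, ‖w (t + s) + w (t - s)‖ ≤ M) (r : ℕ) :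
    ∀ s ∈ Set.Icc (0 : ℝ) b,
      ‖evenRemainder B w t r s‖ ≤ M * ‖B‖ ^ r * s ^ (2 * r) / (2 * r).factorial := by
  induction r with
  | zero => intro s hs; simpa [evenRemainder] using hM s hs
  | succ r ih =>
    set H : ℝ → E := fun s => w' (t + s) - w' (t - s)
      - ∑ k ∈ Finset.range r, (2 * s ^ (2 * k + 1) / (2 * k + 1).factorial) • (B^[k + 1]) (w t)
      with hH
    have add_deriv : ∀ s : ℝ, HasDerivAt (fun s => t + s) 1 s := fun s => by
      simpa using (hasDerivAt_id s).const_add t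
    have sub_deriv : ∀ s : ℝ, HasDerivAt (fun s => t - s) (-1) s := fun s => by
      simpa using (hasDerivAt_id s).const_sub t
    have dH : ∀ s, HasDerivAt H (B (evenRemainder B w t r s)) s := by
      intro s
      have h1 := (hw' (t + s)).scomp s (add_deriv s)
      have h2 := (hw' (t - s)).scomp s (sub_deriv s)
      refine ((h1.sub h2).sub (hasDerivAt_odd_sum B (w t) r s)).congr_deriv ?_
      simp [evenRemainder, map_sub, map_add]
    have dG : ∀ s, HasDerivAt (evenRemainder B w t (r + 1)) (H s) s := by
      intro s
      have h1 := (hw (t + s)).scomp s (add_deriv s)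
      have h2 := (hw (t - s)).scomp s (sub_deriv s)
      refine ((h1.add h2).sub (hasDerivAt_even_sum B (w t) r s)).congr_deriv ?_
      simp [hH, sub_eq_add_neg]
    have pow_deriv : ∀ (K : ℝ) (n : ℕ) (s : ℝ), HasDerivAt
        (fun s : ℝ => K * s ^ (n + 1) / (n + 1).factorial) (K * s ^ n / n.factorial) s := by
      intro K n s
      refine (((hasDerivAt_pow (n + 1) s).const_mul K).div_const _).congr_deriv ?_
      rw [Nat.factorial_succ, Nat.add_sub_cancel]
      have : (n.factorial : ℝ) ≠ 0 := by positivity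
      push_cast
      field_simp
    have bH : ∀ s ∈ Set.Icc (0 : ℝ) b,
        ‖H s‖ ≤ M * ‖B‖ ^ (r + 1) * s ^ (2 * r + 1) / (2 * r + 1).factorial := by
      refine image_norm_le_of_norm_deriv_right_le_deriv_boundary
        (fun s _ => (dH s).continuousAt.continuousWithinAt)
        (fun s _ => (dH s).hasDerivWithinAt) (by simp [hH])
        (pow_deriv (M * ‖B‖ ^ (r + 1)) (2 * r)) ?_
      intro s hs
      refine (B.le_opNorm _).trans ?_
      have := mul_le_mul_of_nonneg_left (ih s (Set.Ico_subset_Icc_self hs)) (norm_nonneg B)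
      refine this.trans (le_of_eq ?_)
      ring
    have h0 : evenRemainder B w t (r + 1) 0 = 0 := by
      rw [evenRemainder, Finset.sum_range_succ']
      simp [two_smul]
    refine image_norm_le_of_norm_deriv_right_le_deriv_boundary
      (fun s _ => (dG s).continuousAt.continuousWithinAt)
      (fun s _ => (dG s).hasDerivWithinAt) (by simp [h0])
      (pow_deriv (M * ‖B‖ ^ (r + 1)) (2 * r + 1)) ?_
    intro s hs
    exact bH s (Set.Ico_subset_Icc_self hs)

theorem evenRemainder_neg (B : E →L[ℝ] E) (w : ℝ → E) (t : ℝ) (r : ℕ) (s : ℝ) :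
    evenRemainder B w t r (-s) = evenRemainder B w t r s := by
  simp only [evenRemainder, (even_two_mul _).neg_pow, sub_neg_eq_add, ← sub_eq_add_neg]
  rw [add_comm (w (t - s))]

theorem evenRemainder_isBigO (B : E →L[ℝ] E) {w w' : ℝ → E}
    (hw : ∀ t, HasDerivAt w (w' t) t) (hw' : ∀ t, HasDerivAt w' (B (w t)) t) (t : ℝ) (r : ℕ) :
    evenRemainder B w t r =O[𝓝 0] fun s : ℝ => s ^ (2 * r) := by
  have hc : Continuous w := continuous_iff_continuousAt.mpr fun t => (hw t).continuousAt
  obtain ⟨M, hM⟩ := isCompact_Icc.exists_bound_of_continuousOn (s := Set.Icc (0 : ℝ) 1)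
    (f := fun s => w (t + s) + w (t - s)) (by fun_prop)
  have key := norm_evenRemainder_le_of_nonneg B hw hw' t hM r
  refine Asymptotics.IsBigO.of_bound (M * ‖B‖ ^ r / (2 * r).factorial) ?_
  filter_upwards [Metric.ball_mem_nhds (0 : ℝ) one_pos] with s hs
  rw [mem_ball_zero_iff, Real.norm_eq_abs] at hs
  have h1 := key |s| ⟨abs_nonneg s, hs.le⟩
  have h2 : evenRemainder B w t r |s| = evenRemainder B w t r s := by
    rcases abs_choice s with h | h <;> rw [h]
    exact evenRemainder_neg B w t r s
  rw [h2] at h1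
  refine h1.trans (le_of_eq ?_)
  rw [norm_pow, Real.norm_eq_abs]
  ring

end

/-! ### The scheme -/

/-- Taylor polynomial of `cos √(-z)`. -/
def cosTaylor (q : ℕ) : ℝ[X] :=
  ∑ k ∈ Finset.range (q + 1), C (((2 * k).factorial : ℝ)⁻¹) * X ^ k

/-- The Taylor polynomial of `cos √(-z)`, damped by a factor which does not affect the order. -/
def dampedCos (q : ℕ) : ℝ[X] :=
  cosTaylor q * (1 - C (((2 * q + 2).factorial : ℝ)⁻¹) * (-X) ^ (q + 1))

/-- The polynomial `∑ a_i z^i` of the stability-enhanced scheme. -/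
def incrementPoly (q : ℕ) : ℝ[X] := 2 * dampedCos q - 2

theorem coeff_cosTaylor (q k : ℕ) :
    (cosTaylor q).coeff k = if k < q + 1 then ((2 * k).factorial : ℝ)⁻¹ else 0 := by
  simp [cosTaylor, coeff_X_pow]

theorem coeff_dampedCos {q k : ℕ} (hk : k ≤ q) :
    (dampedCos q).coeff k = ((2 * k).factorial : ℝ)⁻¹ := by
  have : dampedCos q = cosTaylor q
      - (cosTaylor q * C (((2 * q + 2).factorial : ℝ)⁻¹ * (-1) ^ (q + 1))) * X ^ (q + 1) := by
    rw [dampedCos, neg_pow, C_mul, C_pow, C_neg, C_1]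
    ring
  rw [this, coeff_sub, coeff_mul_X_pow', if_neg (by omega), coeff_cosTaylor, if_pos (by omega),
    sub_zero]

theorem coeff_incrementPoly_succ {q k : ℕ} (hk : k + 1 ≤ q) :
    (incrementPoly q).coeff (k + 1) = 2 / (2 * (k + 1)).factorial := by
  have e : incrementPoly q = C 2 * dampedCos q - C 2 := rfl
  rw [e, coeff_sub, coeff_C_mul, coeff_dampedCos hk, coeff_C_succ, sub_zero]
  rfl

theorem coeff_incrementPoly_zero (q : ℕ) : (incrementPoly q).coeff 0 = 0 := by
  have e : incrementPoly q = C 2 * dampedCos q - C 2 := rfl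
  rw [e, coeff_sub, coeff_C_mul, coeff_dampedCos (Nat.zero_le q), coeff_C_zero]
  simp

theorem natDegree_incrementPoly_le (q : ℕ) : (incrementPoly q).natDegree ≤ 2 * q + 1 := by
  have e : incrementPoly q = C 2 * dampedCos q - C 2 := rfl
  have h1 : (cosTaylor q).natDegree ≤ q :=
    natDegree_sum_le_of_forall_le _ _ fun k hk => (natDegree_C_mul_X_pow_le _ _).trans
      (by simp at hk; omega)
  rw [e, natDegree_sub_C]
  refine (natDegree_C_mul_le _ _).trans (natDegree_mul_le_of_le h1 ?_ |>.trans_eq (by ring :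
    q + (q + 1) = 2 * q + 1))
  refine (natDegree_sub_le _ _).trans (max_le (by simp) ((natDegree_C_mul_le _ _).trans ?_))
  refine natDegree_pow_le.trans ?_
  simp

/-- The stability-enhanced leap-frog scheme of order `q`. -/
def enhancedScheme (q : ℕ) : LeapFrogScheme where
  len := 2 * q + 1
  coeff i := (incrementPoly q).coeff (i.val + 1)

theorem increment_enhancedScheme {E : Type} [AddCommGroup E] [Module ℝ E] (q : ℕ) (B : E → E)
    (dt : ℝ) (x : E) :
    (enhancedScheme q).increment B dt x = ∑ k ∈ Finset.range (2 * q + 1),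
      ((incrementPoly q).coeff (k + 1) * dt ^ (2 * (k + 1))) • (B^[k + 1]) x := by
  rw [Finset.sum_range]
  rfl

/-- The coefficients of degree `1` to `q` cancel the Taylor terms exactly. What is left is a Taylor
remainder and terms with powers `2(k + 1)`, `k ≥ q`, of the step, all `O(dt^{2q+2})`, which is more
than required. -/
theorem hasOrder_enhancedScheme {q : ℕ} : (enhancedScheme q).HasOrder q := by
  intro E _ _ B w w' hw hw' t
  have split : ∀ dt : ℝ, w (t + dt) - (2 : ℝ) • w t + w (t - dt)
        - (enhancedScheme q).increment B dt (w t)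
      = evenRemainder B w t (q + 1) dt - ∑ k ∈ Finset.Ico q (2 * q + 1),
        dt ^ (2 * (k + 1)) • (incrementPoly q).coeff (k + 1) • (B^[k + 1]) (w t) := by
    intro dt
    rw [increment_enhancedScheme, evenRemainder, Finset.sum_range_succ' _ q,
      ← Finset.sum_range_add_sum_Ico _ (by omega : q ≤ 2 * q + 1)]
    have e1 : ∑ k ∈ Finset.range q,
        ((incrementPoly q).coeff (k + 1) * dt ^ (2 * (k + 1))) • (B^[k + 1]) (w t)
        = ∑ k ∈ Finset.range q,
          (2 * dt ^ (2 * (k + 1)) / (2 * (k + 1)).factorial) • (B^[k + 1]) (w t) := by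
      refine Finset.sum_congr rfl fun k hk => ?_
      rw [coeff_incrementPoly_succ (by simp at hk; omega)]
      congr 1
      ring
    have e2 : ∀ k, ((incrementPoly q).coeff (k + 1) * dt ^ (2 * (k + 1))) • (B^[k + 1]) (w t)
        = dt ^ (2 * (k + 1)) • (incrementPoly q).coeff (k + 1) • (B^[k + 1]) (w t) := by
      intro k
      rw [smul_smul, mul_comm]
    rw [e1, Finset.sum_congr rfl fun k _ => e2 k]
    simp only [mul_zero, pow_zero, Nat.factorial_zero, Nat.cast_one, div_one, mul_one,
      Function.iterate_zero, id_eq]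
    abel
  simp only [split]
  have pow_le : ∀ n, q + 2 ≤ n → (fun dt : ℝ => dt ^ n) =O[𝓝 0] fun dt : ℝ => dt ^ (q + 2) := by
    intro n hn
    refine Asymptotics.IsBigO.of_bound 1 ?_
    filter_upwards [Metric.ball_mem_nhds (0 : ℝ) one_pos] with s hs
    rw [mem_ball_zero_iff] at hs
    rw [norm_pow, norm_pow, one_mul]
    exact pow_le_pow_of_le_one (norm_nonneg _) hs.le hn
  refine Asymptotics.IsBigO.sub ?_ (Asymptotics.IsBigO.fun_sum fun k hk => ?_)
  · exact (evenRemainder_isBigO B hw hw' t (q + 1)).trans (pow_le _ (by omega))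
  · rw [Finset.mem_Ico] at hk
    refine Asymptotics.IsBigO.trans ?_ (pow_le (2 * (k + 1)) (by omega))
    refine Asymptotics.IsBigO.of_bound ‖(incrementPoly q).coeff (k + 1) • (B^[k + 1]) (w t)‖
      (Filter.Eventually.of_forall fun dt => ?_)
    rw [norm_smul, mul_comm]

/-! ### The stability polynomial on the negative axis -/

theorem abs_eval_cosTaylor_le (q : ℕ) {x : ℝ} (hx : 0 ≤ x) :
    |(cosTaylor q).eval (-(x ^ 2))| ≤ 1 + x ^ (2 * q + 2) / (2 * q + 2).factorial := by
  -- At `t = 0` the even part of `cos` is `2 cos x`; hence the bound `M = 2`, and the factor 2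
  -- cancels at the end.
  have h := norm_evenRemainder_le_of_nonneg (E := ℝ) (-(ContinuousLinearMap.id ℝ ℝ))
    (w := Real.cos) (w' := fun t => -Real.sin t) Real.hasDerivAt_cos
    (fun t => by simpa using (Real.hasDerivAt_sin t).fun_neg) 0 (b := x) (M := 2)
    (fun s _ => by
      rw [zero_add, zero_sub, Real.cos_neg, ← two_mul, norm_mul]
      simpa using Real.abs_cos_le_one s) (q + 1) x ⟨hx, le_rfl⟩
  have it : ∀ k : ℕ, ((-(ContinuousLinearMap.id ℝ ℝ) : ℝ →L[ℝ] ℝ)^[k]) (1 : ℝ) = (-1) ^ k := by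
    intro k
    induction k with
    | zero => simp
    | succ k ih => rw [Function.iterate_succ_apply', ih, pow_succ]; simp
  have e : evenRemainder (-(ContinuousLinearMap.id ℝ ℝ)) Real.cos 0 (q + 1) x
      = 2 * (Real.cos x - (cosTaylor q).eval (-(x ^ 2))) := by
    rw [evenRemainder, Real.cos_zero, cosTaylor, eval_finsetSum, mul_sub, Finset.mul_sum]
    congr 1
    · simp; ring
    · refine Finset.sum_congr rfl fun k _ => ?_
      rw [it, eval_mul, eval_C, eval_pow, eval_X, neg_pow (x ^ 2), ← pow_mul, smul_eq_mul]
      ring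
  rw [e, norm_neg, ContinuousLinearMap.norm_id, one_pow, mul_one, norm_mul, Real.norm_eq_abs,
    Real.norm_eq_abs, abs_two, mul_div_assoc, show 2 * (q + 1) = 2 * q + 2 by ring] at h
  have h1 := le_of_mul_le_mul_left h two_pos
  have h2 := Real.abs_cos_le_one x
  have h3 := abs_sub_abs_le_abs_sub ((cosTaylor q).eval (-(x ^ 2))) (Real.cos x)
  rw [abs_sub_comm] at h3
  linarith

/-- This follows from `n^n / n! ≤ e^n ≤ 3^n`. It is the reason why the stability interval, measured
in `x = √(-z)`, grows linearly with the degree. -/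
theorem pow_le_factorial {n : ℕ} {x : ℝ} (hx : 0 ≤ x) (hxn : 3 * x ≤ n) :
    x ^ n ≤ n.factorial := by
  have h1 := Real.pow_div_factorial_le_exp (x := (n : ℝ)) (by positivity) n
  have h2 : Real.exp n ≤ 3 ^ n := by
    rw [← mul_one (n : ℝ), Real.exp_nat_mul]
    have := Real.exp_one_lt_d9
    exact pow_le_pow_left₀ (Real.exp_pos _).le (by linarith) n
  have h3 : (3 * x) ^ n ≤ (n : ℝ) ^ n := pow_le_pow_left₀ (by positivity) hxn n
  rw [div_le_iff₀ (by positivity)] at h1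
  have h4 : (3 : ℝ) ^ n * x ^ n ≤ 3 ^ n * n.factorial := by
    rw [← mul_pow]
    exact h3.trans (h1.trans (mul_le_mul_of_nonneg_right h2 (by positivity)))
  exact le_of_mul_le_mul_left h4 (by positivity)

/-- The damping factor at `-(x ^ 2)` is `1 - u`, where `u` is the Taylor error bound, and `(1 + u)(1
- u) = 1 - u² < 1`. -/
theorem abs_eval_dampedCos_lt (q : ℕ) {x : ℝ} (hx : 0 < x) (hxq : 3 * x ≤ 2 * q + 2) :
    |(dampedCos q).eval (-(x ^ 2))| < 1 := by
  have h1 := abs_eval_cosTaylor_le q hx.le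
  have h2 := pow_le_factorial (n := 2 * q + 2) hx.le (by push_cast; linarith)
  set u := x ^ (2 * q + 2) / (2 * q + 2).factorial with hu
  have hu0 : 0 < u := by positivity
  have hu1 : u ≤ 1 := by rw [hu, div_le_one (by positivity)]; exact h2
  have e : (dampedCos q).eval (-(x ^ 2)) = (cosTaylor q).eval (-(x ^ 2)) * (1 - u) := by
    rw [dampedCos, eval_mul, eval_sub, eval_one, eval_mul, eval_C, eval_pow, eval_neg, eval_X,
      neg_neg, ← pow_mul, hu, show 2 * (q + 1) = 2 * q + 2 by ring]
    ring
  rw [e, abs_mul, abs_of_nonneg (by linarith : 0 ≤ 1 - u)]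
  have := mul_le_mul_of_nonneg_right h1 (by linarith : 0 ≤ 1 - u)
  nlinarith

theorem eval_incrementPoly (q : ℕ) (z : ℝ) :
    (incrementPoly q).eval z = 2 * (dampedCos q).eval z - 2 := by
  have e : incrementPoly q = C 2 * dampedCos q - C 2 := rfl
  rw [e, eval_sub, eval_mul, eval_C]

theorem incrementPoly_eq (q : ℕ) : incrementPoly q = X * (incrementPoly q).divX := by
  conv_lhs => rw [← X_mul_divX_add (incrementPoly q), coeff_incrementPoly_zero, C_0, add_zero]

/-- Up to a bounded factor, the increment polynomial is `z`, and it stays away from `-4`. -/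
theorem exists_bounds_incrementPoly {q : ℕ} (hq : 1 ≤ q) {M : ℝ} (hM : 0 ≤ M)
    (hMq : 3 * M ≤ 2 * q + 2) :
    ∃ ε G : ℝ, 0 < ε ∧ 0 < G ∧ ∀ z ∈ Set.Icc (-(M ^ 2)) 0,
      ε ≤ (incrementPoly q).divX.eval z ∧ (incrementPoly q).divX.eval z ≤ G ∧
      ε ≤ 4 + (incrementPoly q).eval z := by
  have hsq : ∀ z ∈ Set.Icc (-(M ^ 2)) 0, z ≠ 0 → ∃ x, 0 < x ∧ x ≤ M ∧ z = -(x ^ 2) := by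
    intro z hz hz0
    have hneg : z < 0 := lt_of_le_of_ne hz.2 hz0
    refine ⟨√(-z), Real.sqrt_pos.mpr (by linarith), ?_, ?_⟩
    · exact Real.sqrt_le_iff.mpr ⟨hM, by linarith [hz.1]⟩
    · rw [Real.sq_sqrt (by linarith)]; ring
  have hev : ∀ z, (incrementPoly q).eval z = z * (incrementPoly q).divX.eval z := by
    intro z
    conv_lhs => rw [incrementPoly_eq, eval_mul, eval_X]
  have hg : ∀ z ∈ Set.Icc (-(M ^ 2)) 0, 0 < (incrementPoly q).divX.eval z := by
    intro z hz
    by_cases hz0 : z = 0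
    -- At `z = 0` the quotient is the linear coefficient `2/2! = 1`; this is where `1 ≤ q` enters.
    · rw [hz0, ← coeff_zero_eq_eval_zero, coeff_divX, coeff_incrementPoly_succ hq]
      positivity
    · obtain ⟨x, hx, hxM, rfl⟩ := hsq z hz hz0
      have h1 := (abs_lt.mp (abs_eval_dampedCos_lt q hx (by linarith))).2
      have h2 := hev (-(x ^ 2))
      rw [eval_incrementPoly] at h2
      have h3 : 0 < x ^ 2 := by positivity
      by_contra hcon
      nlinarith
  have hf : ∀ z ∈ Set.Icc (-(M ^ 2)) 0, 0 < 4 + (incrementPoly q).eval z := by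
    intro z hz
    by_cases hz0 : z = 0
    · rw [hev, hz0]; norm_num
    · obtain ⟨x, hx, hxM, rfl⟩ := hsq z hz hz0
      have h1 := (abs_lt.mp (abs_eval_dampedCos_lt q hx (by linarith))).1
      rw [eval_incrementPoly]
      linarith
  -- Compactness turns the pointwise strict inequalities into uniform ones, with constants depending
  -- on `q` and `M` alone.
  have hne : (Set.Icc (-(M ^ 2)) 0).Nonempty := ⟨0, by simp [sq_nonneg], le_rfl⟩
  obtain ⟨a, ha, hamin⟩ := isCompact_Icc.exists_isMinOn hne
    (f := fun z => (incrementPoly q).divX.eval z) (by fun_prop)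
  obtain ⟨b, hb, hbmin⟩ := isCompact_Icc.exists_isMinOn hne
    (f := fun z => 4 + (incrementPoly q).eval z) (by fun_prop)
  obtain ⟨d, hd, hdmax⟩ := isCompact_Icc.exists_isMaxOn hne
    (f := fun z => (incrementPoly q).divX.eval z) (by fun_prop)
  refine ⟨min ((incrementPoly q).divX.eval a) (4 + (incrementPoly q).eval b),
    (incrementPoly q).divX.eval d, lt_min (hg a ha) (hf b hb), hg d hd, fun z hz => ⟨?_, ?_, ?_⟩⟩
  · exact (min_le_left _ _).trans (hamin hz)
  · exact hdmax hz
  · exact (min_le_right _ _).trans (hbmin hz)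

/-! ### Functional calculus for the square of a skew-symmetric operator -/

section
variable {H : Type*} [NormedAddCommGroup H] [InnerProductSpace ℝ H] [FiniteDimensional ℝ H]

/-- In an orthonormal eigenbasis the form is a sum of squares weighted by the values of `p` at the
eigenvalues; the bounds on the Rayleigh quotient place these in `[a, b]`. -/
theorem inner_aeval_nonneg {Z : H →ₗ[ℝ] H} (hZ : Z.IsSymmetric) {a b : ℝ}
    (hlo : ∀ x, a * ‖x‖ ^ 2 ≤ inner ℝ (Z x) x) (hhi : ∀ x, inner ℝ (Z x) x ≤ b * ‖x‖ ^ 2)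
    {p : ℝ[X]} (hp : ∀ z ∈ Set.Icc a b, 0 ≤ p.eval z) (x : H) :
    0 ≤ inner ℝ (aeval Z p x) x := by
  set e := hZ.eigenvectorBasis rfl with he
  set lam := hZ.eigenvalues rfl with hlam
  have hmem : ∀ i, lam i ∈ Set.Icc a b := by
    intro i
    have h1 : inner ℝ (Z (e i)) (e i) = lam i := by
      rw [he, hZ.apply_eigenvectorBasis, ← he, inner_smul_left, real_inner_self_eq_norm_sq,
        e.orthonormal.1 i]
      simp [hlam]
    have h2 := hlo (e i)
    have h3 := hhi (e i)
    rw [h1, e.orthonormal.1 i] at h2 h3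
    exact ⟨by linarith, by linarith⟩
  have hx : x = ∑ i, e.repr x i • e i := (e.sum_repr x).symm
  have hpx : aeval Z p x = ∑ i, (p.eval (lam i) * e.repr x i) • e i := by
    conv_lhs => rw [hx]
    rw [map_sum]
    refine Finset.sum_congr rfl fun i _ => ?_
    rw [map_smul, Module.End.aeval_apply_of_hasEigenvector
      (hZ.hasEigenvector_eigenvectorBasis rfl i), smul_smul, mul_comm]
    rfl
  rw [hpx]
  nth_rewrite 2 [hx]
  rw [e.orthonormal.inner_sum]
  refine Finset.sum_nonneg fun i _ => ?_
  simp only [conj_trivial]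
  have := mul_nonneg (hp _ (hmem i)) (mul_self_nonneg (e.repr x i))
  linarith
end

section
variable {V : Type*} [SeminormedAddCommGroup V] [InnerProductSpace ℝ V] 

theorem inner_aeval_comm {Z : V →ₗ[ℝ] V} (hZ : ∀ x y, inner ℝ (Z x) y = inner ℝ x (Z y))
    (p : ℝ[X]) (x y : V) : inner ℝ (aeval Z p x) y = inner ℝ x (aeval Z p y) := by
  induction p using Polynomial.induction_on' with
  | add p q hp hq => simp only [map_add, LinearMap.add_apply, inner_add_left, inner_add_right, hp, hq]
  | monomial n a =>
    simp only [aeval_monomial, Module.End.mul_apply, Module.algebraMap_end_apply, inner_smul_left,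
      inner_smul_right, conj_trivial]
    congr 1
    induction n generalizing x y with
    | zero => simp
    | succ n ih =>
      rw [pow_succ', Module.End.mul_apply, hZ, ih, ← Module.End.mul_apply, ← pow_succ, pow_succ']

theorem sq_comm_of_skew {l : V →ₗ[ℝ] V} (hl : ∀ x y, inner ℝ (l x) y = -inner ℝ x (l y)) (x y : V) :
    inner ℝ ((l * l) x) y = inner ℝ x ((l * l) y) := by
  rw [Module.End.mul_apply, hl, hl, neg_neg, Module.End.mul_apply]

variable [FiniteDimensional ℝ V] {l : V →ₗ[ℝ] V} {M : ℝ}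

/-- The energy is only a seminorm, so the spectral theorem is applied on the separation quotient.
The map `l` descends to it by boundedness, and there its square is symmetric with Rayleigh quotients
in `[-M², 0]`. -/
theorem inner_aeval_sq_nonneg (hl : ∀ x y, inner ℝ (l x) y = -inner ℝ x (l y))
    (hM : ∀ x, ‖l x‖ ≤ M * ‖x‖) {p : ℝ[X]}
    (hp : ∀ z ∈ Set.Icc (-(M ^ 2)) 0, 0 ≤ p.eval z) (x : V) :
    0 ≤ inner ℝ (aeval (l * l) p x) x := by
  let J : V →L[ℝ] SeparationQuotient V := SeparationQuotient.mkCLM ℝ V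
  let lc : V →L[ℝ] V := l.mkContinuous M hM
  let k : SeparationQuotient V →L[ℝ] SeparationQuotient V :=
    SeparationQuotient.liftCLM (J ∘L lc) (fun x y h =>
      (h.map (J ∘L lc).continuous).eq)
  have hk : ∀ x, k (J x) = J (l x) := fun x => rfl
  have hJ : ∀ x y, inner ℝ (J x) (J y) = inner ℝ x y := fun x y => rfl
  have hJn : ∀ x, ‖J x‖ = ‖x‖ := fun x => rfl
  have hsurj : ∀ x', ∃ x, J x = x' := SeparationQuotient.surjective_mk
  let Z : SeparationQuotient V →ₗ[ℝ] SeparationQuotient V := k.toLinearMap * k.toLinearMap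
  have hZ : ∀ x, Z (J x) = J ((l * l) x) := fun x => rfl
  have hlsq : ∀ x, inner ℝ ((l * l) x) x = -‖l x‖ ^ 2 := fun x => by
    rw [Module.End.mul_apply, hl, real_inner_self_eq_norm_sq]
  have haev : ∀ (p : ℝ[X]) (x : V), aeval Z p (J x) = J (aeval (l * l) p x) := by
    intro p x
    induction p using Polynomial.induction_on' with
    | add p q hp hq => simp only [map_add, LinearMap.add_apply, hp, hq]
    | monomial n a =>
      simp only [aeval_monomial, Module.End.mul_apply, Module.algebraMap_end_apply, map_smul]
      congr 1
      induction n with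
      | zero => simp
      | succ n ih => rw [pow_succ', Module.End.mul_apply, ih, hZ, pow_succ', ← Module.End.mul_apply]
  rw [← hJ, ← haev]
  refine inner_aeval_nonneg (a := -(M ^ 2)) (b := 0) ?_ ?_ ?_ hp (J x)
  · intro x' y'
    obtain ⟨x, rfl⟩ := hsurj x'
    obtain ⟨y, rfl⟩ := hsurj y'
    rw [hZ, hZ, hJ, hJ, Module.End.mul_apply, hl, hl, neg_neg, Module.End.mul_apply]
  · intro x'
    obtain ⟨x, rfl⟩ := hsurj x'
    rw [hZ, hJ, hlsq, hJn, neg_mul, neg_le_neg_iff, ← mul_pow]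
    exact pow_le_pow_left₀ (norm_nonneg _) (hM x) 2
  · intro x'
    obtain ⟨x, rfl⟩ := hsurj x'
    rw [hZ, hJ, hlsq]
    nlinarith [sq_nonneg ‖l x‖]

theorem norm_aeval_sq_le (hl : ∀ x y, inner ℝ (l x) y = -inner ℝ x (l y))
    (hM : ∀ x, ‖l x‖ ≤ M * ‖x‖) {p : ℝ[X]} {K : ℝ} (hK : 0 ≤ K)
    (hp : ∀ z ∈ Set.Icc (-(M ^ 2)) 0, p.eval z ^ 2 ≤ K ^ 2) (x : V) :
    ‖aeval (l * l) p x‖ ≤ K * ‖x‖ := by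
  -- The norm bound is the positivity of `K² - p²`.
  have h := inner_aeval_sq_nonneg hl hM (p := C (K ^ 2) - p * p) (fun z hz => by
    rw [eval_sub, eval_C, eval_mul, ← sq, sub_nonneg]; exact hp z hz) x
  rw [map_sub, map_mul, LinearMap.sub_apply, Module.End.mul_apply, inner_sub_left,
    inner_aeval_comm (sq_comm_of_skew hl) p, real_inner_self_eq_norm_sq, aeval_C,
    Module.algebraMap_end_apply, inner_smul_left, real_inner_self_eq_norm_sq] at h
  simp only [conj_trivial] at h
  refine abs_le_of_sq_le_sq' ?_ (by positivity) |>.2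
  rw [mul_pow]
  linarith

theorem norm_apply_aeval_sq_le (hl : ∀ x y, inner ℝ (l x) y = -inner ℝ x (l y))
    (hM : ∀ x, ‖l x‖ ≤ M * ‖x‖) {p : ℝ[X]} {K : ℝ} (hK : 0 ≤ K)
    (hp : ∀ z ∈ Set.Icc (-(M ^ 2)) 0, -z * p.eval z ^ 2 ≤ K ^ 2) (x : V) :
    ‖l (aeval (l * l) p x)‖ ≤ K * ‖x‖ := by
  -- By skewness `‖l p(l²) x‖²` is minus the form of `z p²`; hence the plus sign.
  have h := inner_aeval_sq_nonneg hl hM (p := C (K ^ 2) + p * (X * p)) (fun z hz => by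
    rw [eval_add, eval_C, eval_mul, eval_mul, eval_X]
    linarith [hp z hz]) x
  rw [map_add, map_mul, map_mul, aeval_X, LinearMap.add_apply, Module.End.mul_apply,
    Module.End.mul_apply, inner_add_left, inner_aeval_comm (sq_comm_of_skew hl) p,
    Module.End.mul_apply, hl, real_inner_self_eq_norm_sq, aeval_C,
    Module.algebraMap_end_apply, inner_smul_left, real_inner_self_eq_norm_sq] at h
  simp only [conj_trivial] at h
  refine abs_le_of_sq_le_sq' ?_ (by positivity) |>.2
  rw [mul_pow]
  linarith

end

/-! ### The solution polynomials of the three-term recursion -/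

/-- The polynomials with `S_0 = 0`, `S_1 = 1`, `S_{n+2} = (2 + P) S_{n+1} - S_n`. -/
def recPoly (P : ℝ[X]) : ℕ → ℝ[X]
  | 0 => 0
  | 1 => 1
  | n + 2 => (2 + P) * recPoly P (n + 1) - recPoly P n

/-- The conserved quadratic form of the three-term recursion, definite when `-4 < P(z) < 0`. -/
theorem recPoly_invariant (P : ℝ[X]) (z : ℝ) (n : ℕ) :
    (recPoly P (n + 1)).eval z ^ 2
      - (2 + P.eval z) * ((recPoly P (n + 1)).eval z * (recPoly P n).eval z)
      + (recPoly P n).eval z ^ 2 = 1 := by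
  induction n with
  | zero => simp [recPoly]
  | succ n ih =>
    have e : (recPoly P (n + 2)).eval z
        = (2 + P.eval z) * (recPoly P (n + 1)).eval z - (recPoly P n).eval z := by
      rw [recPoly, eval_sub, eval_mul, eval_add, eval_ofNat]
    rw [e, ← ih]
    ring

/-- The uniform bound for the differences of the solution polynomials. -/
theorem recPoly_sub_sq_le {P : ℝ[X]} {z ε : ℝ} (hε : 0 < ε) (h1 : P.eval z ≤ 0)
    (h2 : ε ≤ 4 + P.eval z) (n : ℕ) :
    ((recPoly P (n + 1) - recPoly P n).eval z) ^ 2 ≤ 4 / ε := by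
  have h := recPoly_invariant P z n
  rw [eval_sub]
  set a := (recPoly P (n + 1)).eval z
  set b := (recPoly P n).eval z
  rw [le_div_iff₀ hε]
  -- Four times the invariant is `(4 + P)(a - b)² + (-P)(a + b)²`.
  nlinarith [mul_nonneg (neg_nonneg.mpr h1) (sq_nonneg (a + b)),
    mul_nonneg (sub_nonneg.mpr h2) (sq_nonneg (a - b))]

/-- Completing the square in the invariant gives `-P (4 + P) b² ≤ 4`. The weight `-z` is unavoidable
when `P` vanishes at `0`, since then `recPoly P n` takes the value `n` there; a factor `l` in front
supplies it. -/
theorem recPoly_sq_le {P : ℝ[X]} {z ε δ : ℝ} (hε : 0 < ε) (hδ : 0 < δ)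
    (h1 : P.eval z ≤ z * δ) (hz : z ≤ 0) (h2 : ε ≤ 4 + P.eval z) (n : ℕ) :
    -z * (recPoly P n).eval z ^ 2 ≤ 4 / (ε * δ) := by
  have h := recPoly_invariant P z n
  set a := (recPoly P (n + 1)).eval z
  set b := (recPoly P n).eval z
  rw [le_div_iff₀ (by positivity)]
  have h3 : (-P.eval z) * (4 + P.eval z) * b ^ 2 ≤ 4 := by
    nlinarith [sq_nonneg (2 * a - (2 + P.eval z) * b)]
  have h4 : -z * δ * ε ≤ (-P.eval z) * (4 + P.eval z) :=
    mul_le_mul (by linarith) h2 hε.le (by nlinarith)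
  nlinarith [mul_le_mul_of_nonneg_right h4 (sq_nonneg b)]

theorem abs_recPoly_le {P : ℝ[X]} {z K : ℝ}
    (h : ∀ n, |(recPoly P (n + 1) - recPoly P n).eval z| ≤ K) (n : ℕ) :
    |(recPoly P n).eval z| ≤ n * K := by
  induction n with
  | zero => simp [recPoly]
  | succ n ih =>
    have h1 := h n
    rw [eval_sub] at h1
    have h2 := abs_add_le ((recPoly P (n + 1)).eval z - (recPoly P n).eval z) ((recPoly P n).eval z)
    rw [sub_add_cancel] at h2
    push_cast
    linarith

/-- For `n ≥ 1` the coefficient of `W 0` in the first formula is `S_n - S_{n-1}` with `S = recPoly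
P`; the form chosen also covers `n = 0`. The two consecutive values are needed together in the
induction. -/
theorem recursion_solution {V : Type*} [AddCommGroup V] [Module ℝ V] (Z : Module.End ℝ V)
    (P : ℝ[X]) {W : ℕ → V}
    (hW : ∀ n, W (n + 2) = (2 : ℝ) • W (n + 1) - W n + aeval Z P (W (n + 1))) (n : ℕ) :
    W n = aeval Z (recPoly P (n + 1) - recPoly P n - P * recPoly P n) (W 0)
        + aeval Z (recPoly P n) (W 1 - W 0) ∧
    W (n + 1) = aeval Z (recPoly P (n + 1) - recPoly P n) (W 0)
      + aeval Z (recPoly P (n + 1)) (W 1 - W 0) := by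
  induction n with
  | zero => simp [recPoly]
  | succ n ih =>
    obtain ⟨ih1, ih2⟩ := ih
    have hS : recPoly P (n + 2) = (2 + P) * recPoly P (n + 1) - recPoly P n := rfl
    refine ⟨?_, ?_⟩
    · rw [hS, show (2 + P) * recPoly P (n + 1) - recPoly P n - recPoly P (n + 1)
        - P * recPoly P (n + 1) = recPoly P (n + 1) - recPoly P n by ring]
      exact ih2
    · have e : ∀ x : V, (2 : ℝ) • x + aeval Z P x = aeval Z (C 2 + P) x := fun x => by
        rw [map_add, aeval_C, LinearMap.add_apply, Module.algebraMap_end_apply]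
      rw [hW, sub_add_eq_add_sub, e, ih2, hS]
      conv_lhs => rw [ih1]
      rw [map_add, ← Module.End.mul_apply, ← Module.End.mul_apply, ← map_mul, ← map_mul,
        add_sub_add_comm, ← LinearMap.sub_apply, ← LinearMap.sub_apply, ← map_sub, ← map_sub]
      have h2 : (C 2 : ℝ[X]) = 2 := rfl
      rw [h2]
      congr 3
      ring

theorem recursion_step {V : Type*} [AddCommGroup V] [Module ℝ V] (Z : Module.End ℝ V)
    (P : ℝ[X]) {W : ℕ → V}
    (hW : ∀ n, W (n + 2) = (2 : ℝ) • W (n + 1) - W n + aeval Z P (W (n + 1))) (n : ℕ) :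
    W (n + 1) - W n = aeval Z (P * recPoly P n) (W 0)
      + aeval Z (recPoly P (n + 1) - recPoly P n) (W 1 - W 0) := by
  obtain ⟨h1, h2⟩ := recursion_solution Z P hW n
  rw [h1, h2, add_sub_add_comm, ← LinearMap.sub_apply, ← LinearMap.sub_apply, ← map_sub,
    ← map_sub]
  congr 3
  ring

/-! ### Stability of the recursion driven by the square of a skew operator. -/

/-- The bounds on the increment polynomial `P = z g` which make the recursion stable. -/
structure StabilityBounds (P : ℝ[X]) (M ε G : ℝ) : Prop where
  pos : 0 < ε
  nonneg : 0 ≤ G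
  eq_X_mul : P = X * P.divX
  le_divX : ∀ z ∈ Set.Icc (-(M ^ 2)) 0, ε ≤ P.divX.eval z
  divX_le : ∀ z ∈ Set.Icc (-(M ^ 2)) 0, P.divX.eval z ≤ G
  le_four_add : ∀ z ∈ Set.Icc (-(M ^ 2)) 0, ε ≤ 4 + P.eval z

/-- The constant in the stability estimates. -/
def stabilityConst (ε G : ℝ) : ℝ := 1 + 4 / ε + 2 / ε + 2 * G / ε

namespace StabilityBounds
variable {P : ℝ[X]} {M ε G : ℝ} (hP : StabilityBounds P M ε G)
include hP

theorem eval_le {z : ℝ} (hz : z ∈ Set.Icc (-(M ^ 2)) 0) : P.eval z ≤ z * ε := by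
  rw [hP.eq_X_mul, eval_mul, eval_X]
  nlinarith [hP.le_divX z hz, hz.2]

theorem stabilityConst_pos : 0 < stabilityConst ε G := by
  have := hP.pos
  have := hP.nonneg
  unfold stabilityConst
  positivity

theorem abs_recPoly_sub_le {z : ℝ} (hz : z ∈ Set.Icc (-(M ^ 2)) 0) (n : ℕ) :
    |(recPoly P (n + 1) - recPoly P n).eval z| ≤ 1 + 4 / ε := by
  have h0 := hP.pos
  have h1 := recPoly_sub_sq_le hP.pos ((hP.eval_le hz).trans (by nlinarith [hz.2]))
    (hP.le_four_add z hz) n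
  have h2 : 0 < 4 / ε := by positivity
  -- The square root of `t = 4/ε` is replaced by the cruder `1 + t`.
  refine abs_le_of_sq_le_sq ?_ (by positivity)
  nlinarith

theorem recPoly_weight_le {z : ℝ} (hz : z ∈ Set.Icc (-(M ^ 2)) 0) (n : ℕ) :
    -z * (recPoly P n).eval z ^ 2 ≤ (2 / ε) ^ 2 := by
  have h0 := hP.pos
  refine (recPoly_sq_le hP.pos hP.pos (hP.eval_le hz) hz.2 (hP.le_four_add z hz) n).trans
    (le_of_eq ?_)
  field_simp
  norm_num

variable {V : Type*} [SeminormedAddCommGroup V] [InnerProductSpace ℝ V] [FiniteDimensional ℝ V]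
  {l : V →ₗ[ℝ] V} (hl : ∀ x y, inner ℝ (l x) y = -inner ℝ x (l y))
  (hM : ∀ x, ‖l x‖ ≤ M * ‖x‖)
include hl hM

theorem norm_sub_le (n : ℕ) (x : V) :
    ‖aeval (l * l) (recPoly P (n + 1) - recPoly P n) x‖ ≤ stabilityConst ε G * ‖x‖ := by
  have h0 := hP.pos
  have h1 := hP.nonneg
  refine (norm_aeval_sq_le hl hM (K := 1 + 4 / ε) (by positivity) (fun z hz => ?_) x).trans
    (mul_le_mul_of_nonneg_right ?_ (norm_nonneg x))
  · exact sq_le_sq.mpr ((hP.abs_recPoly_sub_le hz n).trans (le_abs_self _))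
  · have : 0 ≤ 2 / ε + 2 * G / ε := by positivity
    unfold stabilityConst
    linarith

theorem norm_start_le (n : ℕ) (x : V) :
    ‖aeval (l * l) (recPoly P (n + 1) - recPoly P n - P * recPoly P n) x‖
      ≤ stabilityConst ε G * ‖x‖ := by
  cases n with
  | zero =>
    have h0 := hP.pos
    have h1 := hP.nonneg
    have : 0 ≤ 4 / ε + 2 / ε + 2 * G / ε := by positivity
    simp only [recPoly, sub_zero, mul_zero, map_one, Module.End.one_apply]
    refine le_mul_of_one_le_left (norm_nonneg x) ?_
    unfold stabilityConst
    linarith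
  | succ n =>
    rw [show recPoly P (n + 1 + 1) - recPoly P (n + 1) - P * recPoly P (n + 1)
      = recPoly P (n + 1) - recPoly P n by rw [recPoly]; ring]
    exact hP.norm_sub_le hl hM n x

theorem norm_recPoly_le (n : ℕ) (x : V) :
    ‖aeval (l * l) (recPoly P n) x‖ ≤ stabilityConst ε G * (n * ‖x‖) := by
  have h0 := hP.pos
  have h1 := hP.nonneg
  refine (norm_aeval_sq_le hl hM (K := n * (1 + 4 / ε)) (by positivity) (fun z hz => ?_) x).trans ?_
  · exact sq_le_sq.mpr ((abs_recPoly_le (hP.abs_recPoly_sub_le hz) n).trans (le_abs_self _))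
  · have : 0 ≤ 2 / ε + 2 * G / ε := by positivity
    rw [mul_comm (n : ℝ), mul_assoc]
    refine mul_le_mul_of_nonneg_right ?_ (by positivity)
    unfold stabilityConst
    linarith

theorem norm_apply_recPoly_le (n : ℕ) (x : V) :
    ‖l (aeval (l * l) (recPoly P n) x)‖ ≤ stabilityConst ε G * ‖x‖ := by
  have h0 := hP.pos
  have h1 := hP.nonneg
  refine (norm_apply_aeval_sq_le hl hM (K := 2 / ε) (by positivity)
    (fun z hz => hP.recPoly_weight_le hz n) x).trans
    (mul_le_mul_of_nonneg_right ?_ (norm_nonneg x))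
  have : 0 ≤ 1 + 4 / ε + 2 * G / ε := by positivity
  unfold stabilityConst
  linarith

theorem norm_apply_divX_mul_recPoly_le (n : ℕ) (x : V) :
    ‖l (aeval (l * l) (P.divX * recPoly P n) x)‖ ≤ stabilityConst ε G * ‖x‖ := by
  have h0 := hP.pos
  have h1 := hP.nonneg
  refine (norm_apply_aeval_sq_le hl hM (K := 2 * G / ε) (by positivity)
    (fun z hz => ?_) x).trans (mul_le_mul_of_nonneg_right ?_ (norm_nonneg x))
  · have h2 := hP.recPoly_weight_le hz n
    have h3 : P.divX.eval z ^ 2 ≤ G ^ 2 :=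
      pow_le_pow_left₀ (h0.le.trans (hP.le_divX z hz)) (hP.divX_le z hz) 2
    rw [eval_mul, mul_pow, mul_left_comm, show 2 * G / ε = G * (2 / ε) by ring, mul_pow]
    exact mul_le_mul h3 h2 (mul_nonneg (neg_nonneg.mpr hz.2) (sq_nonneg _)) (by positivity)
  · have : 0 ≤ 1 + 4 / ε + 2 / ε := by positivity
    unfold stabilityConst
    linarith

omit hP hl hM [FiniteDimensional ℝ V] in
theorem aeval_sq_apply_comm (l : V →ₗ[ℝ] V) (p : ℝ[X]) (x : V) :
    aeval (l * l) p (l x) = l (aeval (l * l) p x) := by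
  have h : Commute l (l * l) := (Commute.refl l).mul_right (Commute.refl l)
  induction p using Polynomial.induction_on' with
  | add p q hp hq => simp only [map_add, LinearMap.add_apply, hp, hq]
  | monomial n a =>
    have := LinearMap.congr_fun (h.pow_right n).eq x
    simp only [Module.End.mul_apply] at this
    simp only [aeval_monomial, Module.End.mul_apply, Module.algebraMap_end_apply, map_smul, this]

omit hl hM [FiniteDimensional ℝ V] in
theorem aeval_mul_recPoly (n : ℕ) (x : V) : aeval (l * l) (P * recPoly P n) x
    = l (l (aeval (l * l) (P.divX * recPoly P n) x)) := by
  -- The first rewrite also changes `P` inside `recPoly`; the last one restores it.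
  conv_lhs => rw [hP.eq_X_mul, mul_assoc, map_mul, aeval_X, ← hP.eq_X_mul]
  rfl

variable {W : ℕ → V}
  (hW : ∀ n, W (n + 2) = (2 : ℝ) • W (n + 1) - W n + aeval (l * l) P (W (n + 1)))
include hW

/-- The linearly growing `S_n(l²)` acts only on `l Z`; commuting `l` outwards gives `l S_n(l²) Z`,
which is uniformly bounded. -/
theorem norm_le_of_start {Z : V} (hZ : W 1 = W 0 + l Z) (n : ℕ) :
    ‖W n‖ ≤ stabilityConst ε G * (‖W 0‖ + ‖Z‖) := by
  have h := (recursion_solution _ P hW n).1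
  rw [hZ, add_sub_cancel_left, aeval_sq_apply_comm] at h
  rw [h, mul_add]
  exact (norm_add_le _ _).trans
    (add_le_add (hP.norm_start_le hl hM n _) (hP.norm_apply_recPoly_le hl hM n _))

/-- Needed for the cell averages: the averages of `l Y` are controlled by the energy of `Y`, while
those of a general increment are invisible to the energy. -/
theorem exists_sub_eq_apply {Z : V} (hZ : W 1 = W 0 + l Z) (n : ℕ) :
    ∃ Y, W (n + 1) - W n = l Y ∧ ‖Y‖ ≤ stabilityConst ε G * (‖W 0‖ + ‖Z‖) := by
  have h := recursion_step _ P hW n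
  rw [hZ, add_sub_cancel_left, aeval_sq_apply_comm, hP.aeval_mul_recPoly, ← map_add] at h
  refine ⟨_, h, ?_⟩
  rw [mul_add]
  exact (norm_add_le _ _).trans
    (add_le_add (hP.norm_apply_divX_mul_recPoly_le hl hM n _) (hP.norm_sub_le hl hM n _))

theorem norm_le_linear (n : ℕ) :
    ‖W n‖ ≤ stabilityConst ε G * (‖W 0‖ + n * ‖W 1 - W 0‖) := by
  rw [(recursion_solution _ P hW n).1, mul_add]
  exact (norm_add_le _ _).trans
    (add_le_add (hP.norm_start_le hl hM n _) (hP.norm_recPoly_le hl hM n _))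

theorem norm_sub_add_norm_apply_le (n : ℕ) :
    ‖W (n + 1) - W n‖ + ‖l (W n)‖
      ≤ 2 * stabilityConst ε G * (‖W 1 - W 0‖ + ‖l (W 0)‖) := by
  have h1 : ‖W (n + 1) - W n‖ ≤ stabilityConst ε G * (‖l (W 0)‖ + ‖W 1 - W 0‖) := by
    -- One of the two factors `l` contained in `P(l²)` is moved onto `W 0`, so that only `l (W 0)`
    -- is measured.
    rw [recursion_step _ P hW n, hP.aeval_mul_recPoly, ← aeval_sq_apply_comm, mul_add]
    exact (norm_add_le _ _).trans
      (add_le_add (hP.norm_apply_divX_mul_recPoly_le hl hM n _) (hP.norm_sub_le hl hM n _))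
  have h2 : ‖l (W n)‖ ≤ stabilityConst ε G * (‖l (W 0)‖ + ‖W 1 - W 0‖) := by
    rw [(recursion_solution _ P hW n).1, map_add, ← aeval_sq_apply_comm, mul_add]
    exact (norm_add_le _ _).trans
      (add_le_add (hP.norm_start_le hl hM n _) (hP.norm_apply_recPoly_le hl hM n _))
  linarith

end StabilityBounds

/-! ### A weighted inverse inequality -/

/-- The Legendre operator `p ↦ (s (h - s) p')'` of the interval `[0, h]`. -/
def legendreOp (h : ℝ) (p : ℝ[X]) : ℝ[X] := derivative (X * (C h - X) * derivative p)

theorem legendreOp_add (h : ℝ) (p q : ℝ[X]) :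
    legendreOp h (p + q) = legendreOp h p + legendreOp h q := by
  simp only [legendreOp, derivative_add, mul_add]

theorem integral_legendreOp_mul (h : ℝ) (p q : ℝ[X]) :
    (∫ s in (0 : ℝ)..h, (legendreOp h p).eval s * q.eval s)
      = - ∫ s in (0 : ℝ)..h, s * (h - s) * ((derivative p).eval s * (derivative q).eval s) := by
  have key := intervalIntegral.integral_mul_deriv_eq_deriv_mul (a := 0) (b := h)
    (u := fun s => (X * (C h - X) * derivative p).eval s) (v := fun s => q.eval s)
    (u' := fun s => (legendreOp h p).eval s) (v' := fun s => (derivative q).eval s)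
    (fun x _ => Polynomial.hasDerivAt _ _) (fun x _ => Polynomial.hasDerivAt _ _)
    (Continuous.intervalIntegrable (by fun_prop) _ _)
    (Continuous.intervalIntegrable (by fun_prop) _ _)
  simp only [eval_mul, eval_X, eval_sub, eval_C, sub_self, mul_zero, zero_mul, zero_sub] at key
  rw [← neg_eq_iff_eq_neg, ← key]
  congr 1
  ext s
  ring

theorem integral_legendreOp_comm (h : ℝ) (p q : ℝ[X]) :
    (∫ s in (0 : ℝ)..h, (legendreOp h p).eval s * q.eval s)
      = ∫ s in (0 : ℝ)..h, (legendreOp h q).eval s * p.eval s := by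
  rw [integral_legendreOp_mul, integral_legendreOp_mul]
  simp only [mul_comm (eval _ (derivative p))]

theorem coeff_legendreOp (h : ℝ) (p : ℝ[X]) (k : ℕ) :
    (legendreOp h p).coeff k
      = h * (k + 1) ^ 2 * p.coeff (k + 1) - k * (k + 1) * p.coeff k := by
  have : X * (C h - X) * derivative p = C h * (derivative p * X) - derivative p * X * X := by ring
  rw [legendreOp, this, coeff_derivative, coeff_sub, coeff_C_mul, coeff_mul_X, coeff_mul_X]
  cases k with
  | zero => simp [coeff_derivative]
  | succ k =>
    rw [coeff_mul_X, coeff_derivative, coeff_derivative]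
    push_cast
    ring

theorem massForm_self_eq_zero {h : ℝ} (hh : 0 < h) {p : ℝ[X]} (hp : massForm h p p = 0) : p = 0 :=
  eq_zero_of_integral_sq hh p hp

theorem massForm_comm (h : ℝ) (p q : ℝ[X]) : massForm h p q = massForm h q p := by
  simp only [massForm_apply, mul_comm (eval _ p)]

theorem massForm_legendreOp_comm (h : ℝ) (p q : ℝ[X]) :
    massForm h (legendreOp h p) q = massForm h (legendreOp h q) p :=
  integral_legendreOp_comm h p q

theorem mem_degreeLT_iff_coeff {n : ℕ} {p : ℝ[X]} :
    p ∈ degreeLT ℝ n ↔ ∀ k, n ≤ k → p.coeff k = 0 := by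
  rw [mem_degreeLT, degree_lt_iff_coeff_zero]

theorem legendreOp_mem {h : ℝ} {n : ℕ} {p : ℝ[X]} (hp : p ∈ degreeLT ℝ n) :
    legendreOp h p ∈ degreeLT ℝ n := by
  rw [mem_degreeLT_iff_coeff] at hp ⊢
  intro k hk
  rw [coeff_legendreOp, hp k hk, hp (k + 1) (by omega)]
  simp

theorem massForm_self_nonneg {h : ℝ} (hh : 0 < h) (p : ℝ[X]) : 0 ≤ massForm h p p :=
  intervalIntegral.integral_nonneg hh.le fun _ _ => mul_self_nonneg _

/-- A polynomial of degree `n` orthogonal to all polynomials of smaller degree is an eigenvector of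
the Legendre operator. -/
theorem legendreOp_of_orthogonal {h : ℝ} (hh : 0 < h) {n : ℕ} {e : ℝ[X]}
    (he : e ∈ degreeLT ℝ (n + 1)) (horth : ∀ q ∈ degreeLT ℝ n, massForm h e q = 0) :
    legendreOp h e = (-(n * (n + 1) : ℝ)) • e := by
  set r := legendreOp h e + (n * (n + 1) : ℝ) • e with hr
  -- The coefficient of `s^n` cancels. As the operator is symmetric and preserves degrees, `r` is
  -- then orthogonal to itself.
  have hmem : r ∈ degreeLT ℝ n := by
    rw [mem_degreeLT_iff_coeff] at he ⊢
    intro k hk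
    rw [hr, coeff_add, coeff_legendreOp, coeff_smul, he (k + 1) (by omega), smul_eq_mul]
    rcases hk.eq_or_lt with rfl | hk
    · ring
    · rw [he k (by omega)]; ring
  have h0 : massForm h r r = 0 := by
    have e0 : massForm h r r = massForm h (legendreOp h e) r
        + massForm h ((n * (n + 1) : ℝ) • e) r := by
      rw [← LinearMap.add_apply, ← map_add]
    rw [e0, massForm_legendreOp_comm, massForm_comm, horth _
      (legendreOp_mem hmem), map_smul, LinearMap.smul_apply, horth _ hmem]
    simp
  have := massForm_self_eq_zero hh h0
  rw [hr] at this
  rw [neg_smul]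
  exact eq_neg_of_add_eq_zero_left this

/-- Induction on the degree: after projecting orthogonally onto lower degrees, the remainder is an
eigenvector, the cross terms vanish, and the eigenvalues `n(n + 1)` increase. -/
theorem neg_massForm_legendreOp_le {h : ℝ} (hh : 0 < h) (n : ℕ) :
    ∀ p ∈ degreeLT ℝ (n + 1), -massForm h (legendreOp h p) p ≤ n * (n + 1) * massForm h p p := by
  induction n with
  | zero =>
    intro p hp
    have hL : legendreOp h p = 0 := by
      have := legendreOp_of_orthogonal hh hp (fun q hq => by
        rw [mem_degreeLT_iff_coeff] at hq
        have : q = 0 := by ext k; simpa using hq k (Nat.zero_le _)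
        rw [this, map_zero])
      simpa using this
    simp [hL]
  | succ n ih =>
    intro p hp
    obtain ⟨r, hr, hrp⟩ := exists_mass hh (n + 1) (massForm h p)
    have horth : ∀ q ∈ degreeLT ℝ (n + 1), massForm h (p - r) q = 0 := by
      intro q hq
      rw [map_sub, LinearMap.sub_apply, ← hrp q hq, massForm_comm h r q, massForm_apply, sub_self]
    have he : p - r ∈ degreeLT ℝ (n + 1 + 1) :=
      Submodule.sub_mem _ hp (degreeLT_mono (Nat.le_succ _) hr)
    set e := p - r with hedef
    have hLe := legendreOp_of_orthogonal hh he horth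
    have hpe : p = r + e := by rw [hedef]; ring
    have h1 := ih r hr
    have h2 := massForm_self_nonneg hh r
    have h3 := massForm_self_nonneg hh e
    have e1 : massForm h (legendreOp h p) p
        = massForm h (legendreOp h r) r - (((n + 1 : ℕ) : ℝ) * ((n + 1 : ℕ) + 1)) * massForm h e e := by
      rw [hpe, legendreOp_add, map_add, map_add, LinearMap.add_apply, LinearMap.add_apply,
        massForm_legendreOp_comm h r e, hLe, map_smul, LinearMap.smul_apply, LinearMap.smul_apply,
        horth r hr]
      simp only [smul_eq_mul]
      ring
    have e2 : massForm h p p = massForm h r r + massForm h e e := by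
      rw [hpe, map_add, map_add, LinearMap.add_apply, LinearMap.add_apply,
        massForm_comm h r e, horth r hr]
      ring
    rw [e1, e2]
    push_cast at *
    nlinarith

/-- Weighted inverse inequality: away from the ends of an interval the derivative of a polynomial of
degree at most `n` costs only a factor `n`. -/
theorem integral_weight_deriv_sq_le {h : ℝ} (hh : 0 < h) (n : ℕ) {p : ℝ[X]}
    (hp : p ∈ degreeLT ℝ (n + 1)) :
    (∫ s in (0 : ℝ)..h, s * (h - s) * ((derivative p).eval s * (derivative p).eval s))
      ≤ n * (n + 1) * ∫ s in (0 : ℝ)..h, p.eval s * p.eval s := by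
  have := neg_massForm_legendreOp_le hh n p hp
  rwa [massForm_apply, integral_legendreOp_mul, neg_neg, massForm_apply] at this

/-! ### The coupling of the two grids -/

/-- The coupling on the right half of a primal element, the left half of a dual one. -/
def couplingR (h : ℝ) (w v : ℝ[X]) : ℝ :=
  w.eval h * v.eval (h / 2) - massForm (h / 2) (taylor (h / 2) (derivative w)) v

/-- The coupling on the left half of a primal element, the right half of a dual one. -/
def couplingL (h : ℝ) (w v : ℝ[X]) : ℝ :=
  -(w.eval 0 * v.eval (h / 2)) - massForm (h / 2) (derivative w) (taylor (h / 2) v)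

theorem integral_right_half (h : ℝ) (f : ℝ → ℝ) :
    (∫ s in (h / 2)..h, f s) = ∫ s in (0 : ℝ)..(h / 2), f (s + h / 2) := by
  rw [intervalIntegral.integral_comp_add_right]
  congr 1 <;> ring

theorem integral_halves (h : ℝ) {f : ℝ → ℝ} (hf : Continuous f) :
    (∫ s in (0 : ℝ)..(h / 2), f s) + (∫ s in (0 : ℝ)..(h / 2), f (s + h / 2))
      = ∫ s in (0 : ℝ)..h, f s := by
  rw [← integral_right_half]
  exact intervalIntegral.integral_add_adjacent_intervals (hf.intervalIntegrable _ _)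
    (hf.intervalIntegrable _ _)

/-- Integration by parts of the fraction `χ(s) = a + b s` of the product only. The choice `χ = 1`
moves the whole derivative onto `v` and gives the form in the velocity equation. The choice `χ =
2s/h` kills the remaining boundary term and makes the weight of each derivative vanish at the end of
its own element. -/
theorem couplingR_eq_integral (h : ℝ) (w v : ℝ[X]) (a b : ℝ) (ha : a + b * (h / 2) = 1) :
    couplingR h w v = (∫ s in (0 : ℝ)..(h / 2), (b * (w.eval (s + h / 2) * v.eval s)
        + (a + b * s) * (w.eval (s + h / 2) * (derivative v).eval s)
        - (1 - (a + b * s)) * ((derivative w).eval (s + h / 2) * v.eval s)))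
        + a * (w.eval (h / 2) * v.eval 0) := by
  have hd : ∀ s : ℝ, HasDerivAt (fun s : ℝ => (a + b * s) * (w.eval (s + h / 2) * v.eval s))
      (b * (w.eval (s + h / 2) * v.eval s)
        + (a + b * s) * ((derivative w).eval (s + h / 2) * v.eval s
          + w.eval (s + h / 2) * (derivative v).eval s)) s := by
    intro s
    have h1 : HasDerivAt (fun s : ℝ => a + b * s) b s := by
      simpa using ((hasDerivAt_id s).const_mul b).const_add a
    have h2 : HasDerivAt (fun s : ℝ => w.eval (s + h / 2)) ((derivative w).eval (s + h / 2)) s :=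
      (w.hasDerivAt (s + h / 2)).comp_add_const s (h / 2)
    exact h1.mul (h2.mul (v.hasDerivAt s))
  have key := intervalIntegral.integral_eq_sub_of_hasDerivAt (a := 0) (b := h / 2)
    (fun s _ => hd s) (Continuous.intervalIntegrable (by fun_prop) _ _)
  have e1 : w.eval h * v.eval (h / 2)
      = (∫ s in (0 : ℝ)..(h / 2), (b * (w.eval (s + h / 2) * v.eval s)
        + (a + b * s) * ((derivative w).eval (s + h / 2) * v.eval s
          + w.eval (s + h / 2) * (derivative v).eval s)))
        + a * (w.eval (h / 2) * v.eval 0) := by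
    rw [key, ha]
    simp
  rw [couplingR, e1, massForm_apply, add_sub_right_comm, ← intervalIntegral.integral_sub
    (Continuous.intervalIntegrable (by fun_prop) _ _)
    (Continuous.intervalIntegrable (by fun_prop) _ _)]
  congr 2
  ext s
  rw [taylor_eval]
  ring

theorem couplingL_eq_integral (h : ℝ) (w v : ℝ[X]) (a b : ℝ) (ha : a = 1) :
    couplingL h w v = (∫ s in (0 : ℝ)..(h / 2), (b * (w.eval s * v.eval (s + h / 2))
        + (a + b * s) * (w.eval s * (derivative v).eval (s + h / 2))
        - (1 - (a + b * s)) * ((derivative w).eval s * v.eval (s + h / 2))))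
        - (a + b * (h / 2)) * (w.eval (h / 2) * v.eval h) := by
  have hd : ∀ s : ℝ, HasDerivAt (fun s : ℝ => (a + b * s) * (w.eval s * v.eval (s + h / 2)))
      (b * (w.eval s * v.eval (s + h / 2))
        + (a + b * s) * ((derivative w).eval s * v.eval (s + h / 2)
          + w.eval s * (derivative v).eval (s + h / 2))) s := by
    intro s
    have h1 : HasDerivAt (fun s : ℝ => a + b * s) b s := by
      simpa using ((hasDerivAt_id s).const_mul b).const_add a
    have h2 : HasDerivAt (fun s : ℝ => v.eval (s + h / 2)) ((derivative v).eval (s + h / 2)) s :=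
      (v.hasDerivAt (s + h / 2)).comp_add_const s (h / 2)
    exact h1.mul ((w.hasDerivAt s).mul h2)
  have key := intervalIntegral.integral_eq_sub_of_hasDerivAt (a := 0) (b := h / 2)
    (fun s _ => hd s) (Continuous.intervalIntegrable (by fun_prop) _ _)
  have e1 : -(w.eval 0 * v.eval (h / 2))
      = (∫ s in (0 : ℝ)..(h / 2), (b * (w.eval s * v.eval (s + h / 2))
        + (a + b * s) * ((derivative w).eval s * v.eval (s + h / 2)
          + w.eval s * (derivative v).eval (s + h / 2))))
        - (a + b * (h / 2)) * (w.eval (h / 2) * v.eval h) := by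
    rw [key, ha]
    simp
  rw [couplingL, e1, massForm_apply, sub_right_comm, ← intervalIntegral.integral_sub
    (Continuous.intervalIntegrable (by fun_prop) _ _)
    (Continuous.intervalIntegrable (by fun_prop) _ _)]
  congr 2
  ext s
  rw [taylor_eval]
  ring

/-- The density which bounds the coupling. -/
def boundDensity (h k m : ℝ) (p : ℝ[X]) (s : ℝ) : ℝ :=
  k * (p.eval s * p.eval s) + m * (s * (h - s) * ((derivative p).eval s * (derivative p).eval s))

theorem continuous_boundDensity (h k m : ℝ) (p : ℝ[X]) : Continuous (boundDensity h k m p) := by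
  unfold boundDensity
  fun_prop

theorem abs_mul_le_weighted {l x y : ℝ} (hl : 0 < l) :
    |x * y| ≤ l / 2 * x ^ 2 + 1 / (2 * l) * y ^ 2 := by
  have h1 : 1 / (2 * l) * y ^ 2 = l / 2 * (y / l) ^ 2 := by field_simp
  have h2 : x * y = l * (x * (y / l)) := by field_simp
  rw [h1, h2, abs_le]
  constructor <;> nlinarith [sq_nonneg (x + y / l), sq_nonneg (x - y / l)]

/-- Pointwise bound of the integrand of the coupling for a linear cut-off function with the values
`χ` and `1 - χ`, in terms of the weights `A ≥ (h χ / 2)²` and `B ≥ (h (1 - χ) / 2)²`. -/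
theorem abs_integrand_le {h l χ b w w' v v' A B : ℝ} (hh : 0 < h) (hl : 0 < l)
    (hb : |b| ≤ 2 / h) (hA : h ^ 2 / 4 * χ ^ 2 ≤ A) (hB : h ^ 2 / 4 * (1 - χ) ^ 2 ≤ B) :
    |b * (w * v) + χ * (w * v') - (1 - χ) * (w' * v)|
      ≤ ((1 / h + l / 2) * (w * w) + 2 / (l * h ^ 2) * (B * (w' * w')))
        + ((1 / h + l / 2) * (v * v) + 2 / (l * h ^ 2) * (A * (v' * v'))) := by
  have h1 : |b * (w * v)| ≤ 1 / h * (w * w) + 1 / h * (v * v) := by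
    rw [abs_mul]
    have h2 : |w * v| ≤ (w * w + v * v) / 2 := by
      rw [abs_le]
      constructor <;> nlinarith [sq_nonneg (w + v), sq_nonneg (w - v)]
    refine (mul_le_mul hb h2 (abs_nonneg _) (by positivity)).trans (le_of_eq ?_)
    ring
  have h2 := abs_mul_le_weighted (x := w) (y := χ * v') hl
  have h3 := abs_mul_le_weighted (x := v) (y := (1 - χ) * w') hl
  have conv : ∀ {y D z : ℝ}, h ^ 2 / 4 * y ^ 2 ≤ D →
      1 / (2 * l) * (y * z) ^ 2 ≤ 2 / (l * h ^ 2) * (D * (z * z)) := by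
    intro y D z hD
    have e : 1 / (2 * l) * (y * z) ^ 2 = 2 / (l * h ^ 2) * (h ^ 2 / 4 * y ^ 2 * (z * z)) := by
      field_simp
      ring
    rw [e]
    exact mul_le_mul_of_nonneg_left (mul_le_mul_of_nonneg_right hD (mul_self_nonneg z))
      (by positivity)
  have h4 := conv (z := v') hA
  have h5 := conv (z := w') hB
  have h6 := abs_sub (b * (w * v) + χ * (w * v')) ((1 - χ) * (w' * v))
  have h7 := abs_add_le (b * (w * v)) (χ * (w * v'))
  have e1 : χ * (w * v') = w * (χ * v') := by ring
  have e2 : (1 - χ) * (w' * v) = v * ((1 - χ) * w') := by ring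
  rw [← e1] at h2
  rw [← e2] at h3
  linarith

theorem abs_couplingR_le {h l : ℝ} (hh : 0 < h) (hl : 0 < l) (w v : ℝ[X]) :
    |couplingR h w v| ≤ (∫ s in (0 : ℝ)..(h / 2),
        boundDensity h (1 / h + l / 2) (2 / (l * h ^ 2)) w (s + h / 2))
      + ∫ s in (0 : ℝ)..(h / 2), boundDensity h (1 / h + l / 2) (2 / (l * h ^ 2)) v s := by
  have c1 := continuous_boundDensity h (1 / h + l / 2) (2 / (l * h ^ 2)) w
  have c2 := continuous_boundDensity h (1 / h + l / 2) (2 / (l * h ^ 2)) v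
  rw [couplingR_eq_integral h w v 0 (2 / h) (by field_simp; norm_num), zero_mul, add_zero,
    ← intervalIntegral.integral_add (Continuous.intervalIntegrable (by fun_prop) _ _)
    (Continuous.intervalIntegrable (by fun_prop) _ _)]
  refine (intervalIntegral.abs_integral_le_integral_abs (by positivity)).trans
    (intervalIntegral.integral_mono_on (by positivity)
      (Continuous.intervalIntegrable (by fun_prop) _ _)
      (Continuous.intervalIntegrable (by fun_prop) _ _) fun s hs => ?_)
  refine abs_integrand_le hh hl (abs_of_pos (by positivity)).le ?_ ?_
  -- On the half element `s ≤ h/2`, hence `s² ≤ s(h - s)`: the squared cut-off is dominated by the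
  -- Legendre weight, here of the dual element and below of the primal one.
  · have e : h ^ 2 / 4 * (0 + 2 / h * s) ^ 2 = s ^ 2 := by field_simp; ring
    rw [e]
    nlinarith [hs.1, hs.2]
  · have e : h ^ 2 / 4 * (1 - (0 + 2 / h * s)) ^ 2 = (h / 2 - s) ^ 2 := by field_simp; ring
    rw [e]
    nlinarith [hs.1, hs.2]

theorem abs_couplingL_le {h l : ℝ} (hh : 0 < h) (hl : 0 < l) (w v : ℝ[X]) :
    |couplingL h w v| ≤ (∫ s in (0 : ℝ)..(h / 2),
        boundDensity h (1 / h + l / 2) (2 / (l * h ^ 2)) w s)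
      + ∫ s in (0 : ℝ)..(h / 2), boundDensity h (1 / h + l / 2) (2 / (l * h ^ 2)) v (s + h / 2) := by
  have c1 := continuous_boundDensity h (1 / h + l / 2) (2 / (l * h ^ 2)) w
  have c2 := continuous_boundDensity h (1 / h + l / 2) (2 / (l * h ^ 2)) v
  have hend : 1 + -(2 / h) * (h / 2) = 0 := by field_simp; norm_num
  rw [couplingL_eq_integral h w v 1 (-(2 / h)) rfl, hend, zero_mul, sub_zero,
    ← intervalIntegral.integral_add (Continuous.intervalIntegrable (by fun_prop) _ _)
    (Continuous.intervalIntegrable (by fun_prop) _ _)]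
  refine (intervalIntegral.abs_integral_le_integral_abs (by positivity)).trans
    (intervalIntegral.integral_mono_on (by positivity)
      (Continuous.intervalIntegrable (by fun_prop) _ _)
      (Continuous.intervalIntegrable (by fun_prop) _ _) fun s hs => ?_)
  refine abs_integrand_le hh hl (by rw [abs_neg, abs_of_pos (by positivity)]) ?_ ?_
  · have e : h ^ 2 / 4 * (1 + -(2 / h) * s) ^ 2 = (h / 2 - s) ^ 2 := by field_simp; ring
    rw [e]
    nlinarith [hs.1, hs.2]
  · have e : h ^ 2 / 4 * (1 - (1 + -(2 / h) * s)) ^ 2 = s ^ 2 := by field_simp; ring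
    rw [e]
    nlinarith [hs.1, hs.2]

/-- The Young parameter `l = 2(n + 1)/h` balances the terms: the first contributes `(n + 2)/h`, the
weighted derivative `n/h`. -/
theorem integral_boundDensity_le {h : ℝ} (hh : 0 < h) (n : ℕ) {p : ℝ[X]}
    (hp : p ∈ degreeLT ℝ (n + 1)) :
    (∫ s in (0 : ℝ)..h, boundDensity h (1 / h + (2 * (n + 1) / h) / 2)
        (2 / (2 * (n + 1) / h * h ^ 2)) p s)
      ≤ (2 * n + 2) / h * massForm h p p := by
  have h1 := integral_weight_deriv_sq_le hh n hp
  unfold boundDensity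
  rw [intervalIntegral.integral_add (Continuous.intervalIntegrable (by fun_prop) _ _)
    (Continuous.intervalIntegrable (by fun_prop) _ _), intervalIntegral.integral_const_mul,
    intervalIntegral.integral_const_mul]
  have h2 := mul_le_mul_of_nonneg_left h1
    (show (0 : ℝ) ≤ 2 / (2 * (n + 1) / h * h ^ 2) by positivity)
  rw [massForm_apply]
  refine (add_le_add le_rfl h2).trans (le_of_eq ?_)
  field_simp
  ring

/-- The coupling form of the staggered method, for primal `w` and dual `v`. -/
def couplingForm [NeZero N] (h : ℝ) (w v : ZMod N → ℝ[X]) : ℝ :=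
  ∑ j : ZMod N, (couplingR h (w j) (v j) + couplingL h (w j) (v (j - 1)))

theorem sum_shift [NeZero N] (f : ZMod N → ℝ) : ∑ j : ZMod N, f (j - 1) = ∑ j : ZMod N, f j :=
  Fintype.sum_equiv (Equiv.subRight 1) _ _ fun _ => rfl

theorem couplingForm_eq [NeZero N] (h : ℝ) (w v : ZMod N → ℝ[X]) :
    couplingForm h w v = ∑ j : ZMod N, (couplingR h (w j) (v j) + couplingL h (w (j + 1)) (v j)) := by
  rw [couplingForm, Finset.sum_add_distrib, Finset.sum_add_distrib]
  congr 1
  rw [← sum_shift (fun j => couplingL h (w (j + 1)) (v j))]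
  simp only [sub_add_cancel]

/-- The bounds on half elements are first reassembled into whole elements of each grid, since the
weighted inverse inequality holds only there. -/
theorem abs_couplingForm_le [NeZero N] {h : ℝ} (hh : 0 < h) (n : ℕ) {w v : ZMod N → ℝ[X]}
    (hw : ∀ j, w j ∈ degreeLT ℝ (n + 1)) (hv : ∀ j, v j ∈ degreeLT ℝ (n + 1)) :
    |couplingForm h w v| ≤ (2 * n + 2) / h
      * ∑ j, (massForm h (w j) (w j) + massForm h (v j) (v j)) := by
  have hl : (0 : ℝ) < 2 * (n + 1) / h := by positivity
  set D := boundDensity h (1 / h + (2 * (n + 1) / h) / 2) (2 / (2 * (n + 1) / h * h ^ 2)) with hD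
  have hhalves : ∀ p, (∫ s in (0 : ℝ)..(h / 2), D p s) + (∫ s in (0 : ℝ)..(h / 2), D p (s + h / 2))
      = ∫ s in (0 : ℝ)..h, D p s := fun p => integral_halves h (continuous_boundDensity _ _ _ _)
  calc |couplingForm h w v|
      ≤ ∑ j : ZMod N, (((∫ s in (0 : ℝ)..(h / 2), D (w j) (s + h / 2))
          + ∫ s in (0 : ℝ)..(h / 2), D (v j) s)
        + ((∫ s in (0 : ℝ)..(h / 2), D (w j) s)
          + ∫ s in (0 : ℝ)..(h / 2), D (v (j - 1)) (s + h / 2))) := by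
        refine (Finset.abs_sum_le_sum_abs _ _).trans (Finset.sum_le_sum fun j _ => ?_)
        exact (abs_add_le _ _).trans
          (add_le_add (abs_couplingR_le hh hl _ _) (abs_couplingL_le hh hl _ _))
    _ = ∑ j, ((∫ s in (0 : ℝ)..h, D (w j) s) + ∫ s in (0 : ℝ)..h, D (v j) s) := by
        simp only [← hhalves, Finset.sum_add_distrib]
        rw [sum_shift fun j => ∫ s in (0 : ℝ)..(h / 2), D (v j) (s + h / 2)]
        ring
    _ ≤ _ := by
        rw [Finset.mul_sum]
        refine Finset.sum_le_sum fun j _ => ?_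
        rw [mul_add]
        exact add_le_add (integral_boundDensity_le hh n (hw j)) (integral_boundDensity_le hh n (hv j))

theorem couplingForm_C_mul [NeZero N] (h a : ℝ) (w v : ZMod N → ℝ[X]) :
    couplingForm h (fun j => a • w j) v = a * couplingForm h w v := by
  simp only [couplingForm, couplingR, couplingL, map_smul, LinearMap.smul_apply,
    eval_smul, smul_eq_mul, Finset.mul_sum]
  refine Finset.sum_congr rfl fun j _ => ?_
  ring

/-! ### The spatial operator -/

/-- With central fluxes both evolution equations involve the same coupling form with the roles of
test function and unknown exchanged and opposite signs; skewness can be read off. -/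
theorem isTimeDerivative_iff {c h : ℝ} (hc : 0 < c) (W R : State N qu qv) :
    IsTimeDerivative c 0 0 h W R ↔
      (∀ (j : ZMod N) (φ : ℝ[X]), φ ∈ degreeLT ℝ (qu + 1) →
        massForm h (derivative φ) (wpoly R j)
          = couplingR h (derivative φ) (vpoly W j) + couplingL h (derivative φ) (vpoly W (j - 1))) ∧
      (∀ (j : ZMod N) (ψ : ℝ[X]), ψ ∈ degreeLT ℝ (qv + 1) →
        massForm h ψ (vpoly R j)
          = -(c ^ 2 * (couplingR h (wpoly W j) ψ + couplingL h (wpoly W (j + 1)) ψ))) ∧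
      ∀ j : ZMod N, massForm h (upoly R j) 1
        = massForm (h / 2) (taylor (h / 2) (vpoly W (j - 1))) 1 + massForm (h / 2) (vpoly W j) 1 := by
  have hc2 : c ^ 2 ≠ 0 := by positivity
  have hu : ∀ (j : ZMod N) (φ : ℝ[X]),
      ((∫ s in (0 : ℝ)..h, c ^ 2 * (derivative φ).eval s * (wpoly R j).eval s)
      + ((∫ s in (0 : ℝ)..(h / 2),
            c ^ 2 * (derivative (derivative φ)).eval s * (vpoly W (j - 1)).eval (s + h / 2))
        + ∫ s in (h / 2)..h,
            c ^ 2 * (derivative (derivative φ)).eval s * (vpoly W j).eval (s - h / 2))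
      = c ^ 2 * (derivative φ).eval h * vStar c 0 h W (j + 1)
        - c ^ 2 * (derivative φ).eval 0 * vStar c 0 h W j) ↔
      massForm h (derivative φ) (wpoly R j)
          = couplingR h (derivative φ) (vpoly W j) + couplingL h (derivative φ) (vpoly W (j - 1)) := by
    intro j φ
    rw [integral_right_half]
    simp only [vStar, couplingR, couplingL, massForm_apply, taylor_eval, mul_assoc,
      intervalIntegral.integral_const_mul, add_sub_cancel_right, zero_mul, sub_zero]
    constructor
    · intro h1
      refine mul_left_cancel₀ hc2 ?_
      linarith
    · intro h1
      rw [h1]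
      ring
  have hv : ∀ (j : ZMod N) (ψ : ℝ[X]),
      ((∫ s in (0 : ℝ)..h, ψ.eval s * (vpoly R j).eval s)
      + ((∫ s in (0 : ℝ)..(h / 2),
            c ^ 2 * (derivative ψ).eval s * (wpoly W j).eval (s + h / 2))
        + ∫ s in (h / 2)..h,
            c ^ 2 * (derivative ψ).eval s * (wpoly W (j + 1)).eval (s - h / 2))
      = c ^ 2 * ψ.eval h * wStar c 0 h W (j + 1)
        - c ^ 2 * ψ.eval 0 * wStar c 0 h W j) ↔
      massForm h ψ (vpoly R j)
          = -(c ^ 2 * (couplingR h (wpoly W j) ψ + couplingL h (wpoly W (j + 1)) ψ)) := by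
    intro j ψ
    have e1 : couplingR h (wpoly W j) ψ = (∫ s in (0 : ℝ)..(h / 2),
        (derivative ψ).eval s * (wpoly W j).eval (s + h / 2))
        + (wpoly W j).eval (h / 2) * ψ.eval 0 := by
      rw [couplingR_eq_integral h _ _ 1 0 (by ring), one_mul]
      congr 2
      ext s
      ring
    have e2 : couplingL h (wpoly W (j + 1)) ψ = (∫ s in (0 : ℝ)..(h / 2),
        (derivative ψ).eval (s + h / 2) * (wpoly W (j + 1)).eval s)
        - (wpoly W (j + 1)).eval (h / 2) * ψ.eval h := by
      rw [couplingL_eq_integral h _ _ 1 0 rfl, zero_mul, add_zero, one_mul]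
      congr 2
      ext s
      ring
    rw [integral_right_half, e1, e2]
    simp only [wStar, massForm_apply, mul_assoc, intervalIntegral.integral_const_mul,
      add_sub_cancel_right, zero_div, zero_mul, sub_zero]
    constructor <;> intro h1 <;> linarith
  have hm : ∀ j : ZMod N, ((∫ s in (0 : ℝ)..h, (upoly R j).eval s)
      = (∫ s in (0 : ℝ)..(h / 2), (vpoly W (j - 1)).eval (s + h / 2))
        + ∫ s in (h / 2)..h, (vpoly W j).eval (s - h / 2)) ↔ massForm h (upoly R j) 1
        = massForm (h / 2) (taylor (h / 2) (vpoly W (j - 1))) 1 + massForm (h / 2) (vpoly W j) 1 := by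
    intro j
    rw [integral_right_half]
    simp only [massForm_apply, taylor_eval, eval_one, mul_one, add_sub_cancel_right]
  constructor
  · rintro ⟨h1, h2, h3⟩
    exact ⟨fun j φ hφ => (hu j φ).mp (h1 j φ hφ), fun j ψ hψ => (hv j ψ).mp (h2 j ψ hψ),
      fun j => (hm j).mp (h3 j)⟩
  · rintro ⟨h1, h2, h3⟩
    exact ⟨fun j φ hφ => (hu j φ).mpr (h1 j φ hφ), fun j ψ hψ => (hv j ψ).mpr (h2 j ψ hψ),
      fun j => (hm j).mpr (h3 j)⟩

theorem upoly_add (W W' : State N qu qv) (j : ZMod N) :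
    upoly (W + W') j = upoly W j + upoly W' j := rfl

theorem vpoly_add (W W' : State N qu qv) (j : ZMod N) :
    vpoly (W + W') j = vpoly W j + vpoly W' j := rfl

theorem upoly_smul (a : ℝ) (W : State N qu qv) (j : ZMod N) :
    upoly (a • W) j = a • upoly W j := rfl

theorem vpoly_smul (a : ℝ) (W : State N qu qv) (j : ZMod N) :
    vpoly (a • W) j = a • vpoly W j := rfl

theorem wpoly_add (W W' : State N qu qv) (j : ZMod N) :
    wpoly (W + W') j = wpoly W j + wpoly W' j := by
  simp only [wpoly, upoly_add, derivative_add]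

theorem wpoly_smul (a : ℝ) (W : State N qu qv) (j : ZMod N) :
    wpoly (a • W) j = a • wpoly W j := by
  simp only [wpoly, upoly_smul, derivative_smul]

theorem spatialOp_add {c h : ℝ} (hc : 0 < c) (hh : 0 < h) (W W' : State N qu qv) :
    spatialOp c 0 0 h (W + W') = spatialOp c 0 0 h W + spatialOp c 0 0 h W' := by
  refine isTimeDerivative_unique hc hh (spatialOp_spec 0 0 hc hh (W + W')) ?_
  obtain ⟨a1, a2, a3⟩ := (isTimeDerivative_iff hc _ _).mp (spatialOp_spec 0 0 hc hh W)
  obtain ⟨b1, b2, b3⟩ := (isTimeDerivative_iff hc _ _).mp (spatialOp_spec 0 0 hc hh W')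
  refine (isTimeDerivative_iff hc _ _).mpr ⟨fun j φ hφ => ?_, fun j ψ hψ => ?_, fun j => ?_⟩
  · rw [wpoly_add, map_add, a1 j φ hφ, b1 j φ hφ]
    simp only [couplingR, couplingL, vpoly_add, eval_add, map_add]
    ring
  · rw [vpoly_add, map_add, a2 j ψ hψ, b2 j ψ hψ]
    simp only [couplingR, couplingL, wpoly_add, eval_add, map_add,
      LinearMap.add_apply]
    ring
  · rw [upoly_add, map_add, LinearMap.add_apply, a3 j, b3 j]
    simp only [vpoly_add, map_add, LinearMap.add_apply]
    ring

theorem spatialOp_smul {c h : ℝ} (hc : 0 < c) (hh : 0 < h) (a : ℝ) (W : State N qu qv) :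
    spatialOp c 0 0 h (a • W) = a • spatialOp c 0 0 h W := by
  refine isTimeDerivative_unique hc hh (spatialOp_spec 0 0 hc hh (a • W)) ?_
  obtain ⟨a1, a2, a3⟩ := (isTimeDerivative_iff hc _ _).mp (spatialOp_spec 0 0 hc hh W)
  refine (isTimeDerivative_iff hc _ _).mpr ⟨fun j φ hφ => ?_, fun j ψ hψ => ?_, fun j => ?_⟩
  · rw [wpoly_smul, map_smul, a1 j φ hφ]
    simp only [couplingR, couplingL, vpoly_smul, eval_smul, map_smul, smul_eq_mul]
    ring
  · rw [vpoly_smul, map_smul, a2 j ψ hψ]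
    simp only [couplingR, couplingL, wpoly_smul, eval_smul, map_smul,
      LinearMap.smul_apply, smul_eq_mul]
    ring
  · rw [upoly_smul, map_smul, LinearMap.smul_apply, a3 j]
    simp only [vpoly_smul, map_smul, LinearMap.smul_apply, smul_eq_mul]
    ring

/-- The spatial operator as a linear map. -/
def spatialLin {c h : ℝ} (hc : 0 < c) (hh : 0 < h) : State N qu qv →ₗ[ℝ] State N qu qv where
  toFun := spatialOp c 0 0 h
  map_add' := spatialOp_add hc hh
  map_smul' := spatialOp_smul hc hh

/-! ### Energy estimates for the spatial operator -/

/-- The semi-inner product of the energy seminorm. -/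
def energyForm [NeZero N] (c h : ℝ) (W X : State N qu qv) : ℝ :=
  ∑ j : ZMod N, (massForm h (c • wpoly W j) (c • wpoly X j) + massForm h (vpoly W j) (vpoly X j))

theorem energyNorm_eq [NeZero N] (c h : ℝ) (W : State N qu qv) :
    energyNorm c h W = √(energyForm c h W W) := by
  simp only [energyNorm, energyForm, massForm_apply, eval_smul, smul_eq_mul, ← sq,
    Finset.sum_add_distrib]

theorem energyForm_comm [NeZero N] (c h : ℝ) (W X : State N qu qv) :
    energyForm c h W X = energyForm c h X W := by
  simp only [energyForm, massForm_comm h (c • wpoly W _), massForm_comm h (vpoly W _)]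

theorem energyForm_add_left [NeZero N] (c h : ℝ) (W W' X : State N qu qv) :
    energyForm c h (W + W') X = energyForm c h W X + energyForm c h W' X := by
  simp only [energyForm, wpoly_add, vpoly_add, smul_add, map_add, LinearMap.add_apply,
    ← Finset.sum_add_distrib]
  exact Finset.sum_congr rfl fun _ _ => by ring

theorem energyForm_smul_left [NeZero N] (c h a : ℝ) (W X : State N qu qv) :
    energyForm c h (a • W) X = a * energyForm c h W X := by
  simp only [energyForm, wpoly_smul, vpoly_smul, smul_comm c a, map_smul, LinearMap.smul_apply,
    smul_eq_mul, Finset.mul_sum, mul_add, mul_left_comm c a]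

theorem energyForm_smul_right [NeZero N] (c h a : ℝ) (W X : State N qu qv) :
    energyForm c h W (a • X) = a * energyForm c h W X := by
  rw [energyForm_comm, energyForm_smul_left, energyForm_comm]

theorem energyForm_self_nonneg [NeZero N] {h : ℝ} (hh : 0 < h) (c : ℝ) (W : State N qu qv) :
    0 ≤ energyForm c h W W :=
  Finset.sum_nonneg fun _ _ => add_nonneg (massForm_self_nonneg hh _) (massForm_self_nonneg hh _)

theorem energyForm_spatialOp [NeZero N] {c h : ℝ} (hc : 0 < c) (hh : 0 < h)
    (W X : State N qu qv) :
    energyForm c h (spatialOp c 0 0 h W) X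
      = c ^ 2 * (couplingForm h (wpoly X) (vpoly W) - couplingForm h (wpoly W) (vpoly X)) := by
  obtain ⟨h1, h2, -⟩ := (isTimeDerivative_iff hc _ _).mp (spatialOp_spec 0 0 hc hh W)
  rw [couplingForm_eq h (wpoly W), couplingForm, ← Finset.sum_sub_distrib, Finset.mul_sum]
  refine Finset.sum_congr rfl fun j _ => ?_
  have e1 := h1 j (upoly X j) (X.1 j).2
  have e2 := h2 j (vpoly X j) (X.2 j).2
  rw [massForm_comm, map_smul, map_smul, LinearMap.smul_apply, massForm_comm h (vpoly _ j), e2]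
  change c • c • massForm h (derivative (upoly X j)) _ + _ = _
  rw [e1]
  simp only [smul_eq_mul]
  simp only [wpoly]
  ring

theorem energyForm_spatialOp_skew [NeZero N] {c h : ℝ} (hc : 0 < c) (hh : 0 < h)
    (W X : State N qu qv) :
    energyForm c h (spatialOp c 0 0 h W) X = -energyForm c h W (spatialOp c 0 0 h X) := by
  rw [energyForm_comm c h W, energyForm_spatialOp hc hh, energyForm_spatialOp hc hh]
  ring

theorem vpoly_mem {n : ℕ} (hv : qv ≤ n) (W : State N qu qv) (j : ZMod N) :
    vpoly W j ∈ degreeLT ℝ (n + 1) :=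
  degreeLT_mono (by omega) (W.2 j).2

theorem wpoly_mem {n : ℕ} (hu : qu ≤ n) (W : State N qu qv) (j : ZMod N) :
    wpoly W j ∈ degreeLT ℝ (n + 1) := by
  have h := mem_degreeLT_iff_coeff.mp (W.1 j).2
  refine mem_degreeLT_iff_coeff.mpr fun k hk => ?_
  rw [wpoly, coeff_derivative, upoly, h (k + 1) (by omega), zero_mul]

theorem energyForm_spatialOp_le [NeZero N] {c h : ℝ} (hc : 0 < c) (hh : 0 < h) {n : ℕ}
    (hu : qu ≤ n) (hv : qv ≤ n) (W X : State N qu qv) :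
    energyForm c h (spatialOp c 0 0 h W) X
      ≤ c * ((2 * n + 2) / h) * (energyForm c h W W + energyForm c h X X) := by
  have key : ∀ W X : State N qu qv, |c * couplingForm h (wpoly W) (vpoly X)|
      ≤ (2 * n + 2) / h * ∑ j, (massForm h (c • wpoly W j) (c • wpoly W j)
        + massForm h (vpoly X j) (vpoly X j)) := by
    intro W X
    rw [← couplingForm_C_mul]
    exact abs_couplingForm_le hh n (fun j => Submodule.smul_mem _ _ (wpoly_mem hu W j))
      (vpoly_mem hv X)
  have h1 := le_of_abs_le (key X W)
  have h2 := neg_le_of_abs_le (key W X)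
  have e : energyForm c h W W + energyForm c h X X
      = (∑ j, (massForm h (c • wpoly X j) (c • wpoly X j) + massForm h (vpoly W j) (vpoly W j)))
        + ∑ j, (massForm h (c • wpoly W j) (c • wpoly W j)
          + massForm h (vpoly X j) (vpoly X j)) := by
    simp only [energyForm, Finset.sum_add_distrib]
    ring
  rw [energyForm_spatialOp hc hh, e]
  have h3 := mul_le_mul_of_nonneg_left (add_le_add h1 (neg_le_neg h2)) hc.le
  linarith

theorem energyNorm_spatialOp_le [NeZero N] {c h : ℝ} (hc : 0 < c) (hh : 0 < h) {n : ℕ}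
    (hu : qu ≤ n) (hv : qv ≤ n) (W : State N qu qv) :
    energyNorm c h (spatialOp c 0 0 h W) ≤ 2 * (c * ((2 * n + 2) / h)) * energyNorm c h W := by
  set k := c * ((2 * n + 2) / h) with hk
  have hk0 : 0 < k := by positivity
  set R := spatialOp c 0 0 h W with hR
  -- Testing with `R / (2k)` gives `‖R‖²/(2k) ≤ k‖W‖² + ‖R‖²/(4k)`, in which the last term is
  -- absorbed.
  have h1 := energyForm_spatialOp_le hc hh hu hv W ((1 / (2 * k)) • R)
  rw [energyForm_smul_right, energyForm_smul_right, energyForm_smul_left, ← hk, ← hR] at h1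
  have h2 : energyForm c h R R ≤ (2 * k) ^ 2 * energyForm c h W W := by
    field_simp at h1
    linarith
  rw [energyNorm_eq, energyNorm_eq]
  refine (Real.sqrt_le_sqrt h2).trans_eq ?_
  rw [Real.sqrt_mul (by positivity), Real.sqrt_sq (by positivity)]

/-! ### Cell averages -/

theorem averageNorm_eq_norm [NeZero N] {h : ℝ} (hh : 0 < h) (W : State N qu qv) :
    averageNorm h W
      = ‖WithLp.toLp 2 (fun j : ZMod N => (√h)⁻¹ * massForm h (upoly W j) 1)‖ := by
  rw [averageNorm, EuclideanSpace.norm_eq]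
  congr 1
  refine Finset.sum_congr rfl fun j _ => ?_
  simp only [massForm_apply, eval_one, mul_one, Real.norm_eq_abs, sq_abs]
  rw [mul_pow, mul_pow, inv_pow, inv_pow, Real.sq_sqrt hh.le]
  field_simp

theorem averageNorm_add_le [NeZero N] {h : ℝ} (hh : 0 < h) (W X : State N qu qv) :
    averageNorm h (W + X) ≤ averageNorm h W + averageNorm h X := by
  simp only [averageNorm_eq_norm hh]
  refine le_trans (le_of_eq ?_) (norm_add_le _ _)
  congr 1
  ext j
  simp [upoly_add, mul_add]

theorem averageNorm_smul [NeZero N] {h : ℝ} (hh : 0 < h) {a : ℝ} (ha : 0 ≤ a)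
    (W : State N qu qv) : averageNorm h (a • W) = a * averageNorm h W := by
  simp only [averageNorm_eq_norm hh]
  rw [← abs_of_nonneg ha, ← Real.norm_eq_abs, ← norm_smul, Real.norm_eq_abs, abs_of_nonneg ha]
  congr 1
  ext j
  simp [upoly_smul, mul_left_comm]

theorem massForm_one_sq_le {h : ℝ} (hh : 0 < h) (p : ℝ[X]) :
    massForm h p 1 ^ 2 ≤ h * massForm h p p := by
  set m := massForm h p 1 with hm
  have h1 := massForm_self_nonneg hh (p - (m / h) • 1)
  have h2 : massForm h (1 : ℝ[X]) 1 = h := by simp [massForm_apply]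
  simp only [map_sub, LinearMap.sub_apply, map_smul, LinearMap.smul_apply, smul_eq_mul,
    massForm_comm h 1 p, h2, ← hm] at h1
  have h3 := mul_nonneg hh.le h1
  have e : h * (massForm h p p - m / h * m - m / h * (m - m / h * h)) = h * massForm h p p - m ^ 2 := by
    field_simp
    ring
  linarith

/-- The mean equation makes the cell averages of the new displacement equal to those of `v`;
Cauchy–Schwarz on the two halves does the rest. -/
theorem averageNorm_spatialOp_le [NeZero N] {c h : ℝ} (hc : 0 < c) (hh : 0 < h)
    (W : State N qu qv) : averageNorm h (spatialOp c 0 0 h W) ≤ energyNorm c h W := by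
  obtain ⟨-, -, h3⟩ := (isTimeDerivative_iff hc _ _).mp (spatialOp_spec 0 0 hc hh W)
  have hh2 : 0 < h / 2 := by positivity
  rw [averageNorm, energyNorm_eq]
  refine Real.sqrt_le_sqrt ?_
  have hhalf : ∀ p : ℝ[X], massForm (h / 2) p p
      + massForm (h / 2) (taylor (h / 2) p) (taylor (h / 2) p) = massForm h p p := by
    intro p
    have := integral_halves h (f := fun s => p.eval s * p.eval s) (by fun_prop)
    simpa only [massForm_apply, taylor_eval] using this
  calc _ ≤ ∑ j : ZMod N, (massForm (h / 2) (taylor (h / 2) (vpoly W (j - 1)))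
          (taylor (h / 2) (vpoly W (j - 1))) + massForm (h / 2) (vpoly W j) (vpoly W j)) := by
        refine Finset.sum_le_sum fun j _ => ?_
        have e := h3 j
        rw [massForm_apply] at e
        simp only [eval_one, mul_one] at e
        rw [e]
        have h4 := massForm_one_sq_le hh2 (taylor (h / 2) (vpoly W (j - 1)))
        have h5 := massForm_one_sq_le hh2 (vpoly W j)
        set a := massForm (h / 2) (taylor (h / 2) (vpoly W (j - 1))) 1
        set b := massForm (h / 2) (vpoly W j) 1
        have e2 : h * (h⁻¹ * (a + b)) ^ 2 = (a + b) ^ 2 / h := by field_simp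
        rw [e2, div_le_iff₀ hh]
        nlinarith [sq_nonneg (a - b)]
    _ = ∑ j : ZMod N, massForm h (vpoly W j) (vpoly W j) := by
        simp only [← hhalf, Finset.sum_add_distrib]
        rw [sum_shift fun j => massForm (h / 2) (taylor (h / 2) (vpoly W j))
          (taylor (h / 2) (vpoly W j))]
        ring
    _ ≤ _ := Finset.sum_le_sum fun j _ => le_add_of_nonneg_left (massForm_self_nonneg hh _)

/-! ### Stability of the fully discrete method -/

theorem increment_eq_aeval {E : Type} [AddCommGroup E] [Module ℝ E] (q : ℕ) (A : E →ₗ[ℝ] E)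
    (dt : ℝ) (x : E) :
    (enhancedScheme q).increment (fun y => A (A y)) dt x
      = aeval ((dt • A) * (dt • A)) (incrementPoly q) x := by
  have hpow : ∀ (k : ℕ) (x : E), (((dt • A) * (dt • A)) ^ k) x
      = dt ^ (2 * k) • ((fun y => A (A y))^[k]) x := by
    intro k
    induction k with
    | zero => intro x; simp
    | succ k ih =>
      intro x
      rw [pow_succ, Module.End.mul_apply, ih, Function.iterate_succ_apply']
      have hA : ∀ (k : ℕ) (a : ℝ) (x : E), ((fun y => A (A y))^[k]) (a • x)
          = a • ((fun y => A (A y))^[k]) x := by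
        intro k
        induction k with
        | zero => intro a x; rfl
        | succ k ih => intro a x; simp only [Function.iterate_succ_apply, map_smul, ih]
      rw [Module.End.mul_apply, LinearMap.smul_apply, LinearMap.smul_apply, map_smul, smul_smul, hA,
        smul_smul, ← Function.iterate_succ_apply' (fun y => A (A y)), Function.iterate_succ_apply]
      congr 1
      ring
  rw [increment_enhancedScheme, aeval_eq_sum_range' (n := 2 * q + 2)
    (Nat.lt_succ_of_le (natDegree_incrementPoly_le q)), Finset.sum_range_succ' _ (2 * q + 1),
    coeff_incrementPoly_zero, zero_smul, add_zero, LinearMap.sum_apply]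
  refine Finset.sum_congr rfl fun k _ => ?_
  rw [LinearMap.smul_apply, hpow, smul_smul]

/-- The semi-inner product space structure of the energy. -/
@[reducible]
def energyCore [NeZero N] {h : ℝ} (hh : 0 < h) (c : ℝ) :
    PreInnerProductSpace.Core ℝ (State N qu qv) where
  inner := energyForm c h
  conj_inner_symm W X := energyForm_comm c h X W
  re_inner_nonneg W := energyForm_self_nonneg hh c W
  add_left := energyForm_add_left c h
  smul_left W X a := energyForm_smul_left c h a W X

theorem averageNorm_le_of_steps [NeZero N] {c h dt K : ℝ} (hc : 0 < c) (hh : 0 < h) (hdt : 0 < dt)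
    {W : ℕ → State N qu qv} (hW : ∀ n, ∃ Y, W (n + 1) - W n = dt • spatialOp c 0 0 h Y ∧
      energyNorm c h Y ≤ K) (n : ℕ) :
    averageNorm h (W n) ≤ averageNorm h (W 0) + n * dt * K := by
  induction n with
  | zero => simp
  | succ n ih =>
    obtain ⟨Y, hY, hYK⟩ := hW n
    rw [← sub_add_cancel (W (n + 1)) (W n), hY]
    have h1 := averageNorm_add_le hh (dt • spatialOp c 0 0 h Y) (W n)
    rw [averageNorm_smul hh hdt.le] at h1
    have h2 := mul_le_mul_of_nonneg_left ((averageNorm_spatialOp_le hc hh Y).trans hYK) hdt.le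
    push_cast
    linarith

theorem energyNorm_smul [NeZero N] {h : ℝ} (c : ℝ) {a : ℝ} (ha : 0 ≤ a)
    (W : State N qu qv) : energyNorm c h (a • W) = a * energyNorm c h W := by
  rw [energyNorm_eq, energyNorm_eq, energyForm_smul_left, energyForm_smul_right, ← mul_assoc,
    Real.sqrt_mul (mul_nonneg ha ha), Real.sqrt_mul_self ha]

theorem isStable_enhancedScheme [NeZero N] {q : ℕ} {ε G : ℝ}
    (hP : StabilityBounds (incrementPoly q) (2 * q / 3) ε G) (hq : 1 ≤ q) (hu : qu ≤ q) (hv : qv ≤ q)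
    {c h dt : ℝ} (hc : 0 < c) (hh : 0 < h) (hdt : 0 < dt) (hcfl : c * dt ≤ 1 / 12 * h) :
    (enhancedScheme q).IsStable (N := N) qu qv c 0 0 h dt (2 * stabilityConst ε G) := by
  let : SeminormedAddCommGroup (State N qu qv) :=
    InnerProductSpace.Core.toSeminormedAddCommGroup (𝕜 := ℝ) (c := energyCore hh c)
  let : InnerProductSpace ℝ (State N qu qv) := InnerProductSpace.ofCore (energyCore hh c)
  have hnorm : ∀ W : State N qu qv, energyNorm c h W = ‖W‖ := fun W => energyNorm_eq c h W
  have hfd : FiniteDimensional ℝ (State N qu qv) := inferInstance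
  set L : State N qu qv →ₗ[ℝ] State N qu qv := spatialLin hc hh with hL
  set l : State N qu qv →ₗ[ℝ] State N qu qv := dt • L with hl
  have hskew : ∀ x y, inner ℝ (l x) y = -inner ℝ x (l y) := by
    intro x y
    change energyForm c h (dt • spatialOp c 0 0 h x) y = -energyForm c h x (dt • spatialOp c 0 0 h y)
    rw [energyForm_smul_left, energyForm_smul_right, energyForm_spatialOp_skew hc hh]
    ring
  have hq' : (1 : ℝ) ≤ q := by exact_mod_cast hq
  have hM : ∀ x, ‖l x‖ ≤ 2 * q / 3 * ‖x‖ := by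
    intro x
    rw [← hnorm, ← hnorm, hl, LinearMap.smul_apply, energyNorm_smul c hdt.le]
    refine (mul_le_mul_of_nonneg_left (energyNorm_spatialOp_le hc hh hu hv x) hdt.le).trans ?_
    rw [← mul_assoc]
    refine mul_le_mul_of_nonneg_right ?_ (Real.sqrt_nonneg _)
    -- With the CFL constant `1/12` this is at most `(q + 1)/3`, hence at most `2q/3` because `q ≥
    -- 1`.
    have e : dt * (2 * (c * ((2 * q + 2) / h))) = c * dt / h * (4 * q + 4) := by ring
    have h1 : c * dt / h ≤ 1 / 12 := by rwa [div_le_iff₀ hh]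
    rw [e]
    nlinarith
  have hrec : ∀ W : ℕ → State N qu qv, (enhancedScheme q).IsDiscreteSolution c 0 0 h dt W →
      ∀ n, W (n + 2) = (2 : ℝ) • W (n + 1) - W n + aeval (l * l) (incrementPoly q) (W (n + 1)) := by
    intro W hW n
    rw [hl, ← increment_eq_aeval]
    exact hW n
  have hK := hP.stabilityConst_pos
  have hpos : ∀ W : State N qu qv, 0 ≤ energyNorm c h W := fun W => Real.sqrt_nonneg _
  refine ⟨fun W hW Z hZ n => ⟨?_, ?_⟩, fun W hW n => ?_, fun W hW n => ?_⟩
  · have h1 := hP.norm_le_of_start hskew hM (hrec W hW) (Z := Z) hZ n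
    rw [← hnorm, ← hnorm, ← hnorm] at h1
    nlinarith [hpos (W 0), hpos Z]
  · have h1 := averageNorm_le_of_steps hc hh hdt (W := W)
      (K := stabilityConst ε G * (energyNorm c h (W 0) + energyNorm c h Z))
      (fun n => by
        obtain ⟨Y, hY, hYK⟩ := hP.exists_sub_eq_apply hskew hM (hrec W hW) (Z := Z) hZ n
        refine ⟨Y, hY, ?_⟩
        rw [hnorm, hnorm, hnorm]
        exact hYK) n
    have h2 : 0 ≤ n * dt * (stabilityConst ε G * (energyNorm c h (W 0) + energyNorm c h Z)) := by
      have := hpos (W 0)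
      have := hpos Z
      positivity
    linarith
  · have h1 := hP.norm_le_linear hskew hM (hrec W hW) n
    rw [← hnorm, ← hnorm, ← hnorm] at h1
    rw [energyNorm_smul c (inv_nonneg.mpr hdt.le)]
    have e : n * dt * (dt⁻¹ * energyNorm c h (W 1 - W 0)) = n * energyNorm c h (W 1 - W 0) := by
      field_simp
    rw [e]
    have h2 : 0 ≤ stabilityConst ε G * (energyNorm c h (W 0) + n * energyNorm c h (W 1 - W 0)) := by
      have := hpos (W 0)
      have := hpos (W 1 - W 0)
      positivity
    linarith
  · have h1 := hP.norm_sub_add_norm_apply_le hskew hM (hrec W hW) n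
    rw [← hnorm, ← hnorm, ← hnorm, ← hnorm] at h1
    have hlx : ∀ x, energyNorm c h (l x) = dt * energyNorm c h (spatialOp c 0 0 h x) :=
      fun x => energyNorm_smul c hdt.le _
    rw [hlx, hlx] at h1
    rw [energyNorm_smul c (inv_nonneg.mpr hdt.le), energyNorm_smul c (inv_nonneg.mpr hdt.le)]
    have h2 := mul_le_mul_of_nonneg_left h1 (inv_nonneg.mpr hdt.le)
    have e : ∀ a b : ℝ, dt⁻¹ * (a + dt * b) = dt⁻¹ * a + b := fun a b => by field_simp
    rw [e, mul_left_comm, e] at h2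
    exact h2

end StaggeredDG

end

/-! ### Choice of the constants and conclusion. -/

theorem theorem3 :
    ∃ C₁ C₂ : ℝ, 0 < C₁ ∧ 0 < C₂ ∧ ∃ S : ℕ → StaggeredDG.LeapFrogScheme,
      ∀ qT : ℕ, 1 ≤ qT →
        (S qT).HasOrder qT ∧ ((S qT).stages : ℝ) ≤ C₂ * qT ∧
        ∃ K : ℝ, ∀ qu qv : ℕ, 1 ≤ qu → max qu qv ≤ qT →
          ∀ (xL xR : ℝ), xL < xR → ∀ (N : ℕ) [NeZero N] (c h dt : ℝ),
            0 < c → h = (xR - xL) / N → 0 < dt → c * dt ≤ C₁ * h →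
            StaggeredDG.LeapFrogScheme.IsStable (N := N) (S qT) qu qv c 0 0 h dt K := by
  -- The `2q + 1` coefficients cost `4q + 2 ≤ 6q` stages. The choice `M = 2q/3` below satisfies `3M
  -- ≤ 2q + 2` and bounds the norm of `dt • L` under the CFL condition.
  refine ⟨1 / 12, 6, by norm_num, by norm_num, StaggeredDG.enhancedScheme, fun qT hqT => ?_⟩
  have hqT' : (1 : ℝ) ≤ qT := by exact_mod_cast hqT
  obtain ⟨ε, G, hε, hG, hb⟩ := StaggeredDG.exists_bounds_incrementPoly hqT
    (M := 2 * qT / 3) (by positivity) (by linarith)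
  have hP : StaggeredDG.StabilityBounds (StaggeredDG.incrementPoly qT) (2 * qT / 3) ε G :=
    ⟨hε, hG.le, StaggeredDG.incrementPoly_eq qT, fun z hz => (hb z hz).1,
      fun z hz => (hb z hz).2.1, fun z hz => (hb z hz).2.2⟩
  refine ⟨StaggeredDG.hasOrder_enhancedScheme, ?_, 2 * StaggeredDG.stabilityConst ε G, ?_⟩
  · have e : (StaggeredDG.enhancedScheme qT).stages = 2 * (2 * qT + 1) := rfl
    rw [e]
    push_cast
    linarith
  · intro qu qv _ hq xL xR hx N _ c h dt hc hh hdt hcfl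
    have hN : (0 : ℝ) < N := by exact_mod_cast Nat.pos_of_ne_zero (NeZero.ne N)
    have hh0 : 0 < h := by
      rw [hh]
      exact div_pos (sub_pos.mpr hx) hN
    exact StaggeredDG.isStable_enhancedScheme hP hqT (le_of_max_le_left hq)
      (le_of_max_le_right hq) hc hh0 hdt hcfl
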